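/- **Setting.** Let $\ell\ge 2$ and let $\Gamma_1,\dots,\Gamma_\ell$ be groups with finite generating sets $S_1,\dots,S_\ell$. Assume that some $\Gamma_i$ is infinite and that some $\Gamma_j$ with $j\ne i$ is non-trivial. Let $X=\{o\}\cup\bigcup_{i}(\Gamma_i\setminus\{\mathrm{id}\})$ (disjoint union) be the set obtained from the $\Gamma_i$ by identifying all their identity elements to one point $o$. Each $\Gamma_i$ acts on $X$ by left translation on its copy $\{o\}\cup(\Gamma_i\setminus\{\mathrm{id}\})$ of $\Gamma_i$ and trivially elsewhere. The group $\Gamma$ of the rooted gluing of the labelled Cayley graphs $(\Gamma_i,S_i)$ is the group of permutations of $X$ generated by all $s\in S_i$, $1\le i\le \ell$; it contains each $\Gamma_i$. Let $\mu_i$ be a symmetric probability measure on $\Gamma_i$ whose support generates $\Gamma_i$, and let $q=\ell^{-1}\sum_{i=1}^{\ell}\mu_i$, a symmetric probability measure on $\Gamma$. For $p\in\{1,2\}$, a group $G$, a symmetric probability measure $\phi$ on $G$ and $v>0$, put $$\Lambda_{p,G,\phi}(v)=\inf\Big\{\tfrac12\sum_{x,y\in G}|f(yx)-f(x)|^p\phi(y)\;:\;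 f:G\to\mathbb R,\ |\mathrm{supp} f|\le v,\ \sum_x |f(x)|^p=1\Big\}\in[0,\infty]$$ ($\inf\emptyset=\infty$) and, for $s>0$, $\Lambda_{p,G,\phi}^{-1}(s)=\inf\{v>0:\Lambda_{p,G,\phi}(v)\le s\}\in[0,\infty]$. Write $\Lambda_{p,i}=\Lambda_{p,\Gamma_i,\mu_i}$, and $x!=\mathrm{Gamma}(x+1)$ (Euler's Gamma function) for real $x\ge0$, $\infty!=\infty$. **Theorem.** Let $p\in\{1,2\}$. There are a constant $c_2=c_2(p)>0$ and, for each $\eta>0$, a constant $c_1=c_1(p,\eta)>0$ such that the following holds for all data as above. There is some $\eta>0$ such that, for every $i$, the set $\{g\in\Gamma_i:\mu_i(g)\ge\eta\}$ generates $\Gamma_i$; and for each such $\eta$, $$\forall\, v,s>0:\qquad \Lambda_{p,\Gamma,q}(v)\ \ge\ \frac{c_1 s}{\ell}\quad\text{whenever}\quad v\le \max_{i:\,|\Gamma_i|=\infty}\big(c_2\,\Lambda_{p,i}^{-1}(s)\big)!\,.$$ In particular, there are $v_0,c,C>0$, which may depend on the data, such that for all $v\ge v_0$ $$\Lambda_{p,\Gamma,q}(v)\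 \ge\ c\,F(Cv),\qquad F(v)=\max_{i:\,|\Gamma_i|=\infty}\Lambda_{p,i}\!\left(\frac{\log(1+v)}{\log(1+\log(1+v))}\right).$$ -/

import Mathlib

open scoped ENNReal

universe u

/-! ### Labelled graphs, their groups, and rooted gluing -/

/-- A labelled graph with vertex set `X` and alphabet `A`, in which every vertex is the origin of
exactly one edge for each letter of `A` and for each inverse letter.  Such a graph is the same thing
as one permutation of `X` per letter: the edge labelled `a` at `x` goes from `x` to `σ a x`, and its
reverse is the edge labelled `a⁻¹` at `σ a x`.  (A self-loop at `x` is a fixed point of `σ a`.) -/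
def LabelledGraph (X A : Type u) : Type u := A → Equiv.Perm X

/-- The group of a labelled graph: the group of permutations of the vertices generated by the
letters. -/
def LabelledGraph.group {X A : Type u} (σ : LabelledGraph X A) : Subgroup (Equiv.Perm X) :=
  Subgroup.closure (Set.range σ)

/-- The labelled Cayley graph of `(G, S)`: the edge labelled `s` at `g` goes to `s * g`. -/
def cayleyGraph {G : Type u} [Group G] (S : Finset G) : LabelledGraph G S :=
  fun s => Equiv.mulLeft (s : G)

/-- The vertex set of the rooted gluing: the common root `o` (that is, `none`) together with the
disjoint union of the sets `X i` without their roots. -/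
abbrev GluedVertices {ι : Type} (X : ι → Type u) (o : ∀ i, X i) : Type u :=
  Option (Σ i, {x : X i // x ≠ o i})

open Classical in
/-- The canonical injection of `X i` into the glued vertex set; it sends the root to the root. -/
noncomputable def gluedEmb {ι : Type} (X : ι → Type u) (o : ∀ i, X i) (i : ι) :
    X i ↪ GluedVertices X o where
  toFun x := if h : x = o i then none else some ⟨i, x, h⟩
  inj' x y hxy := by
    by_cases hx : x = o i <;> by_cases hy : y = o i
    · rw [hx, hy]
    · simp [hx, hy] at hxy
    · simp [hx, hy] at hxy
    · simpa [hx, hy] using hxy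

/-- The rooted gluing of labelled graphs with disjoint alphabets.  A letter of the `i`-th alphabet
acts on the copy of `X i` as before and has self-loops at all the other vertices. -/
noncomputable def rootedGluing {ι : Type} {X : ι → Type u} (o : ∀ i, X i) {A : ι → Type u}
    (σ : ∀ i, LabelledGraph (X i) (A i)) : LabelledGraph (GluedVertices X o) (Σ i, A i) :=
  fun a => (σ a.1 a.2).viaEmbedding (gluedEmb X o a.1)

section Gluing

variable {ℓ : ℕ} {G : Fin ℓ → Type u} [∀ i, Group (G i)]

/-- The group of the rooted gluing, at the identity elements, of the labelled Cayley graphs of the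
pairs `(G i, S i)`. -/
noncomputable def gluedGroup (S : ∀ i, Finset (G i)) :
    Subgroup (Equiv.Perm (GluedVertices G fun _ => 1)) :=
  (rootedGluing (fun _ => 1) fun i => cayleyGraph (S i)).group

/-- The action of `G i` on the glued vertices: left translation on the copy of `G i`, trivial
elsewhere. -/
noncomputable def gluedAction (i : Fin ℓ) :
    G i →* Equiv.Perm (GluedVertices G fun _ => 1) :=
  (Equiv.Perm.viaEmbeddingHom (gluedEmb G (fun _ => 1) i)).comp (MulAction.toPermHom (G i) (G i))

theorem gluedAction_mem (S : ∀ i, Finset (G i))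
    (hS : ∀ i, Subgroup.closure (S i : Set (G i)) = ⊤) (i : Fin ℓ) (g : G i) :
    gluedAction i g ∈ gluedGroup S := by
  have h : Subgroup.closure (S i : Set (G i)) ≤ (gluedGroup S).comap (gluedAction i) := by
    rw [Subgroup.closure_le]
    intro s hs
    exact Subgroup.subset_closure ⟨⟨i, ⟨s, hs⟩⟩, rfl⟩
  exact h (by rw [hS i]; trivial)

/-- `G i` viewed as a subgroup of the glued group. -/
noncomputable def gluedIncl (S : ∀ i, Finset (G i))
    (hS : ∀ i, Subgroup.closure (S i : Set (G i)) = ⊤) (i : Fin ℓ) : G i →* gluedGroup S :=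
  (gluedAction i).codRestrict (gluedGroup S) (gluedAction_mem S hS i)

/-- The measure `q = ℓ⁻¹ ∑ μ i` on the glued group. -/
noncomputable def gluedMeasure (S : ∀ i, Finset (G i))
    (hS : ∀ i, Subgroup.closure (S i : Set (G i)) = ⊤) (μ : ∀ i, PMF (G i)) :
    gluedGroup S → ℝ≥0∞ :=
  fun γ => (ℓ : ℝ≥0∞)⁻¹ * ∑ i, (μ i).map (gluedIncl S hS i) γ

end Gluing

/-! ### Isoperimetric profiles -/

/-- `(1/2) ∑_{x,y} |f(yx) - f(x)|^p φ(y)`; for `p = 2` this is the Dirichlet form of `φ`. -/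
noncomputable def energy {G : Type u} [Group G] (p : ℕ) (φ : G → ℝ≥0∞) (f : G → ℝ) : ℝ≥0∞ :=
  2⁻¹ * ∑' x, ∑' y, ENNReal.ofReal (|f (y * x) - f x| ^ p) * φ y

/-- The infimum of the energy over the functions supported in `Ω` with `‖f‖_p = 1`; for `p = 2`
this is the lowest Dirichlet eigenvalue of `Ω`. -/
noncomputable def lowestEnergy {G : Type u} [Group G] (p : ℕ) (φ : G → ℝ≥0∞) (Ω : Finset G) :
    ℝ≥0∞ :=
  ⨅ (f : G → ℝ) (_ : Function.support f ⊆ (Ω : Set G)) (_ : ∑ x ∈ Ω, |f x| ^ p = 1), energy p φ f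

/-- The `L^p`-isoperimetric profile `Λ_{p,G,φ}` (`p = 1, 2`), with values in `[0, ∞]`. -/
noncomputable def profile {G : Type u} [Group G] (p : ℕ) (φ : G → ℝ≥0∞) (v : ℝ) : ℝ≥0∞ :=
  ⨅ (Ω : Finset G) (_ : (Ω.card : ℝ) ≤ v), lowestEnergy p φ Ω

/-- The right-continuous inverse `Λ⁻¹(s) = inf {v > 0 : Λ(v) ≤ s}`, with values in `[0, ∞]`. -/
noncomputable def rcInverse (Λ : ℝ → ℝ≥0∞) (s : ℝ) : ℝ≥0∞ :=
  ⨅ (v : ℝ) (_ : 0 < v) (_ : Λ v ≤ ENNReal.ofReal s), ENNReal.ofReal v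

open Classical in
/-- The factorial of an element of `[0, ∞]`: `x! = Γ(x + 1)` for finite `x`, and `∞! = ∞`. -/
noncomputable def extFactorial (x : ℝ≥0∞) : ℝ≥0∞ :=
  if x = ∞ then ∞ else ENNReal.ofReal (Real.Gamma (x.toReal + 1))

/-- `log(1+v) / log(1+log(1+v))`. -/
noncomputable def logRatio (v : ℝ) : ℝ :=
  Real.log (1 + v) / Real.log (1 + Real.log (1 + v))

/-!
Let `G i` be infinite and `G k`, `k ≠ i`, nontrivial. For `a ∈ G i` and `b ∈ G k` different from the
identity, the commutator `t = a b a⁻¹ b⁻¹` acts on the glued vertices as the three-cycle `(o, a, b)`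
(`cyclicSwitch_commutator`). Its conjugates by `h ∈ G i` are the three-cycles `(h, h a, b)`: seen
from a moving position in `G i`, the element `t` is a switch acting at that position.

Main bound. Let `f` be a function on the glued group of energy much smaller than `s / ℓ`, and let
`N` be at most the inverse profile of `G i` at `s`. Then `f` has small energy along the cosets of
`G i` and is nearly invariant under `t`, as `a` and `b` can be taken of mass at least `η`.
Subtracting from `|f|` its `N`-th largest value on each coset leaves a function whose support has
fewer than `N` points in each coset, hence a small one (`mul_sum_le_energyAlong`). By the coarea
formula (`exists_level_set`), some level set of `|f| ^ p` is nearly invariant under `t` and meets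
most of its cosets in at least `N` points. It contains a nonempty subset in which *every* coset has
`N / 6` points that `t` keeps in the subset (`exists_thick_subset`): a subset of minimal cost per
point has this property. In such a set one can apply successively three-cycles `(h, h a, b)`, with
about `N / 6` choices of `h` each time; if the pairs `{h, h a}` are kept disjoint, the product
remembers all the choices, and distinct products lie in distinct cosets since a nontrivial element
of `G i` moves infinitely many vertices (`CyclicSwitch.factorial_le_card`). So the support of `f`
has at least `(N / 18)!` points.

Asymptotic bound. For `w = log (1 + v) / log (1 + log (1 + v))` and large `v` one has `v ≤ (4 w)!`
(`eventually_le_gamma_logRatio`), so the main bound gives the claim with the profile of `G i`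
evaluated at a large multiple `B w` of `w`. It remains to compare the profile at `w` and at `B w`;
by iteration, at `v` and at `33 / 32 * v` (`profile_le_mul_profile`). Suppose that it drops by a
large factor between these points. Then a nearly optimal `f` at the second one can be truncated to
nearly an indicator function of a set `Ω`. The products of `f` with its right translates, taken in
the sense of minima, have in total an energy at most `4 |Ω|` times that of `f`
(`tsum_energy_min_le`). Since the group is infinite, some left translate `z Ω` meets `Ω` in about
half of its points (`exists_half_translate`). So a fixed proportion of the pairs `(x, y)` of points
of `Ω` has `x ∈ z Ω` and `y ∉ z Ω`, and few of them have an `x⁻¹ y` by which the right translate of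
`Ω` nearly coincides with `Ω`; hence a fixed proportion of the pairs comes from right translates
meeting `Ω` in at most `v` points (`card_pairs_le`). Applying the definition of the
profile at `v` to the corresponding minima shows that the drop was bounded after all.
-/

open Filter

/-! ### Energies and isoperimetric profiles -/

section Profile

variable {G : Type u} [Group G]

theorem energy_mono_of_abs_le {p : ℕ} {φ : G → ℝ≥0∞} {f h : G → ℝ}
    (hfh : ∀ x y, |h (y * x) - h x| ≤ |f (y * x) - f x|) : energy p φ h ≤ energy p φ f := by
  unfold energy
  refine mul_le_mul_right (ENNReal.tsum_le_tsum fun x => ENNReal.tsum_le_tsum fun y => ?_) _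
  exact mul_le_mul_left (ENNReal.ofReal_le_ofReal (pow_le_pow_left₀ (abs_nonneg _) (hfh x y) p)) _

theorem energy_div_const {p : ℕ} (φ : G → ℝ≥0∞) (f : G → ℝ) {r : ℝ} (hr : 0 < r) :
    energy p φ (fun x => f x / r) = (ENNReal.ofReal (r ^ p))⁻¹ * energy p φ f := by
  have hterm : ∀ x y : G, ENNReal.ofReal (|f (y * x) / r - f x / r| ^ p) * φ y =
      (ENNReal.ofReal (r ^ p))⁻¹ * (ENNReal.ofReal (|f (y * x) - f x| ^ p) * φ y) := by
    intro x y
    rw [← sub_div, abs_div, abs_of_pos hr, div_pow, div_eq_inv_mul, ENNReal.ofReal_mul (by positivity),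
      ENNReal.ofReal_inv_of_pos (by positivity), mul_assoc]
  unfold energy
  simp_rw [hterm, ENNReal.tsum_mul_left]
  ring

theorem profile_antitone (p : ℕ) (φ : G → ℝ≥0∞) : Antitone (profile p φ) := by
  intro v w hvw
  unfold profile
  exact le_iInf₂ fun Ω hΩ => iInf₂_le Ω (hΩ.trans hvw)

theorem profile_le_energy {p : ℕ} {φ : G → ℝ≥0∞} {v : ℝ} {Ω : Finset G} {f : G → ℝ}
    (hΩ : (Ω.card : ℝ) ≤ v) (hf : Function.support f ⊆ (Ω : Set G))
    (h1 : ∑ x ∈ Ω, |f x| ^ p = 1) : profile p φ v ≤ energy p φ f :=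
  (iInf₂_le Ω hΩ).trans ((iInf_le _ f).trans (iInf₂_le hf h1))

theorem le_profile {p : ℕ} {φ : G → ℝ≥0∞} {v : ℝ} {c : ℝ≥0∞}
    (h : ∀ (Ω : Finset G) (f : G → ℝ), (Ω.card : ℝ) ≤ v → Function.support f ⊆ (Ω : Set G) →
      ∑ x ∈ Ω, |f x| ^ p = 1 → c ≤ energy p φ f) : c ≤ profile p φ v :=
  le_iInf₂ fun Ω hΩ => le_iInf fun f => le_iInf₂ fun hf h1 => h Ω f hΩ hf h1

/-- The homogeneous form of the definition of the profile. -/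
theorem profile_mul_le_energy {p : ℕ} (hp : p ≠ 0) (φ : G → ℝ≥0∞) {v : ℝ} {Ω : Finset G}
    {f : G → ℝ} (hΩ : (Ω.card : ℝ) ≤ v) (hf : Function.support f ⊆ (Ω : Set G)) :
    profile p φ v * ENNReal.ofReal (∑ x ∈ Ω, |f x| ^ p) ≤ energy p φ f := by
  set c := ∑ x ∈ Ω, |f x| ^ p with hc
  rcases (show 0 ≤ c by positivity).eq_or_lt with h0 | h0
  · simp [← h0]
  set r := c ^ (p : ℝ)⁻¹ with hr
  have hr0 : 0 < r := by positivity
  have hrp : r ^ p = c := Real.rpow_inv_natCast_pow h0.le hp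
  have h1 : profile p φ v ≤ energy p φ (fun x => f x / r) := by
    refine profile_le_energy hΩ (fun x hx => hf ?_) ?_
    · simp only [Function.mem_support] at hx ⊢
      contrapose! hx
      simp [hx]
    · simp_rw [abs_div, abs_of_pos hr0, div_pow, hrp, ← Finset.sum_div]
      exact div_self h0.ne'
  rw [energy_div_const φ f hr0, hrp] at h1
  calc profile p φ v * ENNReal.ofReal c
      ≤ (ENNReal.ofReal c)⁻¹ * energy p φ f * ENNReal.ofReal c := by gcongr
    _ = energy p φ f * ((ENNReal.ofReal c)⁻¹ * ENNReal.ofReal c) := by ring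
    _ = energy p φ f := by
        rw [ENNReal.inv_mul_cancel (by simpa using h0) ENNReal.ofReal_ne_top, mul_one]

theorem profile_eq_top_of_lt_one (p : ℕ) (φ : G → ℝ≥0∞) {v : ℝ} (hv : v < 1) :
    profile p φ v = ∞ := by
  rw [← top_le_iff]
  refine le_profile fun Ω f hΩ hf h1 => ?_
  have : Ω = ∅ := by
    rw [← Finset.card_eq_zero]
    have : (Ω.card : ℝ) < 1 := hΩ.trans_lt hv
    exact_mod_cast Nat.lt_one_iff.mp (by exact_mod_cast this)
  simp [this] at h1

open Classical in
/-- The energy of the indicator function of a point is at most `1`. -/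
theorem profile_le_one {p : ℕ} (hp : p ≠ 0) (μ : PMF G) {v : ℝ} (hv : 1 ≤ v) :
    profile p μ v ≤ 1 := by
  set f : G → ℝ := Pi.single 1 1 with hf
  have hle : profile p μ v ≤ energy p μ f := by
    refine profile_le_energy (Ω := {1}) (by simpa using hv) ?_ (by simp [hf])
    intro x hx
    by_contra h
    simp only [Finset.coe_singleton, Set.mem_singleton_iff] at h
    simp [hf, h] at hx
  refine hle.trans ?_
  have hterm : ∀ x y : G, ENNReal.ofReal (|f (y * x) - f x| ^ p) * μ y ≤
      (if y = x⁻¹ then μ y else 0) + (if x = 1 then μ y else 0) := by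
    intro x y
    have hyx : y = x⁻¹ ↔ y * x = 1 := eq_inv_iff_mul_eq_one
    by_cases h2 : x = 1
    · subst h2
      by_cases h1 : y = 1 <;> simp [hf, h1, hp]
    · by_cases h1 : y * x = 1 <;> simp [hf, hyx, h1, h2, hp]
  have hsum : ∑' x, ∑' y, ENNReal.ofReal (|f (y * x) - f x| ^ p) * μ y ≤ 1 + 1 := by
    calc _ ≤ ∑' x : G, ∑' y : G, ((if y = x⁻¹ then μ y else 0) + (if x = 1 then μ y else 0)) :=
          ENNReal.tsum_le_tsum fun x => ENNReal.tsum_le_tsum fun y => hterm x y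
      _ = ∑' x : G, μ x⁻¹ + ∑' y : G, μ y := by
          simp_rw [ENNReal.tsum_add]
          congr 1
          · simp
          · rw [ENNReal.tsum_comm]; simp
      _ = 1 + 1 := by
          rw [← μ.tsum_coe, ← (Equiv.inv G).tsum_eq (fun x => μ x)]
          rfl
  calc energy p μ f ≤ 2⁻¹ * (1 + 1) := by unfold energy; gcongr
    _ = 1 := by
      rw [one_add_one_eq_two]
      exact ENNReal.inv_mul_cancel (by simp) (by simp)

end Profile

/-! ### Level sets -/

/-- The `N`-th largest value `τ` of a positive function on a finite set: fewer than `N` values are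
larger than `τ`, and at least `N` values are at least `τ`. -/
theorem exists_level {α : Type*} (B : Finset α) (h : α → ℝ) {N : ℕ} (hN : 1 ≤ N)
    (hB : N ≤ B.card) :
    ∃ x ∈ B, (B.filter fun y => h x < h y).card < N ∧ N ≤ (B.filter fun y => h x ≤ h y).card := by
  classical
  set T := B.filter fun x => N ≤ (B.filter fun y => h x ≤ h y).card with hT
  have hTne : T.Nonempty := by
    obtain ⟨x, hx, hmin⟩ := B.exists_min_image h (Finset.card_pos.mp (hN.trans hB))
    refine ⟨x, Finset.mem_filter.mpr ⟨hx, ?_⟩⟩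
    rwa [Finset.filter_true_of_mem hmin]
  obtain ⟨x, hx, hmax⟩ := T.exists_max_image h hTne
  obtain ⟨hxB, hxN⟩ := Finset.mem_filter.mp hx
  refine ⟨x, hxB, ?_, hxN⟩
  by_contra! hlt
  obtain ⟨z, hz, hzmin⟩ := (B.filter fun y => h x < h y).exists_min_image h
    (Finset.card_pos.mp (hN.trans hlt))
  obtain ⟨hzB, hxz⟩ := Finset.mem_filter.mp hz
  have hzT : z ∈ T := by
    refine Finset.mem_filter.mpr ⟨hzB, hlt.trans (Finset.card_le_card fun y hy => ?_)⟩
    exact Finset.mem_filter.mpr ⟨(Finset.mem_filter.mp hy).1, hzmin y hy⟩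
  exact absurd (hmax z hzT) (not_le.mpr hxz)

/-- The increment of `t ↦ t ^ p` (`p = 1, 2`) is controlled by the `p`-th power of the increment
of `t`, at the price of a small multiple of `t ^ p`. -/
theorem pow_sub_pow_le {p : ℕ} (hp : p = 1 ∨ p = 2) {K t τ : ℝ} (hK : 1 ≤ K) (ht : 0 ≤ t) :
    t ^ p - τ ^ p ≤ K * max (t - τ) 0 ^ p + t ^ p / K := by
  have hK0 : 0 < K := by linarith
  rcases le_total t τ with h | h
  · have : t ^ p ≤ τ ^ p := pow_le_pow_left₀ ht h p
    have h2 : 0 ≤ K * max (t - τ) 0 ^ p + t ^ p / K := by positivity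
    linarith
  · rw [max_eq_left (by linarith)]
    rcases hp with rfl | rfl
    · have : 0 ≤ t / K := by positivity
      simp only [pow_one]
      nlinarith
    · have h1 : t ^ 2 - τ ^ 2 ≤ 2 * (t - τ) * t := by nlinarith
      have h2 : 2 * (t - τ) * t ≤ K * (t - τ) ^ 2 + t ^ 2 / K := by
        have : 0 ≤ (K * (t - τ) - t) ^ 2 / K := by positivity
        have e : (K * (t - τ) - t) ^ 2 / K =
            K * (t - τ) ^ 2 - 2 * (t - τ) * t + t ^ 2 / K := by
          field_simp
          ring
        linarith
      linarith

/-- Averaging over the level sets of `w` (the coarea formula): if the three sums on the left are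
jointly small compared with `∑ w`, then some level set contains few points of each kind. -/
theorem exists_level_set {α : Type*} (Ω : Finset α) (w u₁ u₂ u₃ : α → ℝ) {δ : ℝ}
    (hδ : 0 ≤ δ) (hw : ∀ x ∈ Ω, 0 ≤ w x)
    (h : ∑ x ∈ Ω, max (w x - u₁ x) 0 + ∑ x ∈ Ω, max (w x - u₂ x) 0 +
      ∑ x ∈ Ω, max (w x - u₃ x) 0 < δ * ∑ x ∈ Ω, w x) :
    ∃ σ : ℝ, 0 ≤ σ ∧ ((Ω.filter fun x => u₁ x ≤ σ ∧ σ < w x).card : ℝ) +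
      ((Ω.filter fun x => u₂ x ≤ σ ∧ σ < w x).card : ℝ) +
      ((Ω.filter fun x => u₃ x ≤ σ ∧ σ < w x).card : ℝ) <
        δ * ((Ω.filter fun x => σ < w x).card : ℝ) := by
  classical
  by_contra! hcon
  -- `c u σ` counts the points with `u ≤ σ < w`
  set c : (α → ℝ) → ℝ → ℝ≥0∞ := fun u σ =>
    ∑ x ∈ Ω, (Set.Ico (u x) (w x)).indicator (fun _ => (1 : ℝ≥0∞)) σ with hc
  have hcard : ∀ u σ, c u σ = ENNReal.ofReal ((Ω.filter fun x => u x ≤ σ ∧ σ < w x).card : ℝ) := by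
    intro u σ
    simp only [hc, Set.indicator_apply, Set.mem_Ico, Finset.sum_boole, ENNReal.ofReal_natCast]
  have hint : ∀ u : α → ℝ, (∫⁻ σ, c u σ) = ENNReal.ofReal (∑ x ∈ Ω, max (w x - u x) 0) := by
    intro u
    rw [hc, MeasureTheory.lintegral_finsetSum _ fun x _ =>
      measurable_const.indicator measurableSet_Ico,
      ENNReal.ofReal_sum_of_nonneg fun x _ => le_max_right _ _]
    refine Finset.sum_congr rfl fun x _ => ?_
    rw [MeasureTheory.lintegral_indicator measurableSet_Ico]
    simp [ENNReal.ofReal_max]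
  have hmeas : ∀ u : α → ℝ, Measurable (c u) := fun u =>
    Finset.measurable_fun_sum _ fun x _ => measurable_const.indicator measurableSet_Ico
  have hpt : ∀ σ, ENNReal.ofReal δ * c (fun _ => 0) σ ≤ c u₁ σ + c u₂ σ + c u₃ σ := by
    intro σ
    rcases le_or_gt 0 σ with h0 | h0
    · simp only [hcard, h0, true_and]
      rw [← ENNReal.ofReal_mul hδ, ← ENNReal.ofReal_add (by positivity) (by positivity),
        ← ENNReal.ofReal_add (by positivity) (by positivity)]
      exact ENNReal.ofReal_le_ofReal (hcon σ h0)
    · simp [hcard, h0.not_ge]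
  have hI := MeasureTheory.lintegral_mono (μ := MeasureTheory.volume) hpt
  rw [MeasureTheory.lintegral_const_mul _ (hmeas _),
    MeasureTheory.lintegral_add_right _ (hmeas _),
    MeasureTheory.lintegral_add_right _ (hmeas _), hint, hint, hint, hint, ← ENNReal.ofReal_mul hδ,
    ← ENNReal.ofReal_add (by positivity) (by positivity),
    ← ENNReal.ofReal_add (by positivity) (by positivity),
    ENNReal.ofReal_le_ofReal_iff (by positivity)] at hI
  have : ∑ x ∈ Ω, max (w x - 0) 0 = ∑ x ∈ Ω, w x :=
    Finset.sum_congr rfl fun x hx => by rw [sub_zero, max_eq_left (hw x hx)]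
  rw [this] at hI
  linarith

/-! ### Extracting a set that is everywhere thick -/

/-- Let `κ` partition the set `α` into fibers and let `t` be a permutation of order dividing three.
If all but a small proportion of the points of `U` lie in a fiber that meets `U` in at least `N`
points and on a `t`-orbit contained in `U`, then some nonempty `W ⊆ U` has the property that
*every* fiber of `W` has at least `N / 6` points that `t` keeps inside `W`. -/
theorem exists_thick_subset {α β : Type*} [DecidableEq α] [DecidableEq β] (κ : α → β)
    (t : Equiv.Perm α) (ht : ∀ x, t (t (t x)) = x) (N : ℕ) (U : Finset α) (hU : U.Nonempty)
    (hcost : 8 * (U.filter fun x => (U.filter fun y => κ y = κ x).card < N).card +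
      2 * (U.filter fun x => t x ∉ U ∨ t.symm x ∉ U).card ≤ U.card) :
    ∃ W ⊆ U, W.Nonempty ∧ ∀ x ∈ W, N ≤ 6 * (W.filter fun y => κ y = κ x ∧ t y ∈ W).card := by
  set small : Finset α → ℕ := fun W =>
    (W.filter fun x => (W.filter fun y => κ y = κ x).card < N).card with hsmall
  set bad : Finset α → ℕ := fun W => (W.filter fun x => t x ∉ W ∨ t.symm x ∉ W).card with hbad
  set cost : Finset α → ℝ := fun W => 4 * small W + bad W with hcostdef
  -- `W` minimizes the cost per point; its fibers cannot be removed profitably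
  obtain ⟨W, hW, hmin⟩ := (U.powerset.filter fun W => W.Nonempty).exists_min_image
    (fun W => cost W / W.card) ⟨U, by simpa using hU⟩
  simp only [Finset.mem_filter, Finset.mem_powerset] at hW hmin
  obtain ⟨hWU, hWne⟩ := hW
  have hWpos : (0 : ℝ) < W.card := by exact_mod_cast hWne.card_pos
  set ρ := cost W / W.card with hρ
  have hρW : cost W = ρ * W.card := by rw [hρ]; field_simp
  have hρ2 : ρ ≤ 1 / 2 := by
    have hUpos : (0 : ℝ) < U.card := by exact_mod_cast hU.card_pos
    refine (hmin U ⟨subset_rfl, hU⟩).trans ?_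
    rw [div_le_iff₀ hUpos]
    have : (8 * small U + 2 * bad U : ℝ) ≤ U.card := by exact_mod_cast hcost
    simp only [hcostdef]
    linarith
  refine ⟨W, hWU, hWne, fun x hx => ?_⟩
  set A := W.filter fun y => κ y = κ x with hA
  have hAW : A ⊆ W := Finset.filter_subset _ _
  have hApos : 0 < A.card := Finset.card_pos.mpr ⟨x, by simp [hA, hx]⟩
  have hcardA : ((W \ A).card : ℝ) = W.card - A.card := by
    rw [Finset.card_sdiff_of_subset hAW, Nat.cast_sub (Finset.card_le_card hAW)]
  -- removing the fiber `A` does not lower the ratio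
  have hremove : cost W ≤ cost (W \ A) + ρ * A.card := by
    have : ρ * (W \ A).card ≤ cost (W \ A) := by
      rcases (W \ A).eq_empty_or_nonempty with h | h
      · simp [h, hcostdef, hsmall, hbad]
      · have := hmin (W \ A) ⟨Finset.sdiff_subset.trans hWU, h⟩
        rwa [le_div_iff₀ (by exact_mod_cast h.card_pos)] at this
    rw [hcardA] at this
    linarith
  -- the fibers other than `A` are untouched
  have hfiber : ∀ z ∈ W \ A, ((W \ A).filter fun y => κ y = κ z) = W.filter fun y => κ y = κ z := by
    intro z hz
    ext y
    simp only [hA, Finset.mem_filter, Finset.mem_sdiff, not_and] at hz ⊢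
    constructor
    · rintro ⟨⟨h1, -⟩, h2⟩
      exact ⟨h1, h2⟩
    · rintro ⟨h1, h2⟩
      exact ⟨⟨h1, fun _ h3 => hz.2 hz.1 (h2.symm.trans h3)⟩, h2⟩
  have hfiberA : ∀ z ∈ A, (W.filter fun y => κ y = κ z) = A := by
    intro z hz
    simp only [hA, Finset.mem_filter] at hz
    rw [hz.2]
  have hs : small W = small (W \ A) + if A.card < N then A.card else 0 := by
    simp only [hsmall]
    rw [Finset.filter_congr (s := W \ A) (fun z hz => by rw [hfiber z hz])]
    conv_lhs => rw [← Finset.sdiff_union_of_subset hAW, Finset.filter_union]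
    rw [Finset.card_union_of_disjoint (Finset.disjoint_filter_filter Finset.sdiff_disjoint),
      Finset.sdiff_union_of_subset hAW]
    congr 1
    rw [Finset.filter_congr (s := A) (fun z hz => by rw [hfiberA z hz])]
    split_ifs with h <;> simp [h]
  set badA := A.filter fun z => t z ∉ W ∨ t.symm z ∉ W with hbadA
  set goodA := A.filter fun z => t z ∈ W ∧ t.symm z ∈ W with hgoodA
  have hsum : A.card = badA.card + goodA.card := by
    rw [← Finset.card_filter_add_card_filter_not (s := A)
      (fun z => t z ∉ W ∨ t.symm z ∉ W)]
    simp only [hbadA, hgoodA, not_or, not_not]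
  -- a point of `W \ A` that becomes bad lies on the `t`-orbit of a good point of `A`
  have hb : bad (W \ A) + badA.card ≤ bad W + 2 * goodA.card := by
    have hsub : ((W \ A).filter fun z => t z ∉ W \ A ∨ t.symm z ∉ W \ A) ∪ badA ⊆
        (W.filter fun z => t z ∉ W ∨ t.symm z ∉ W) ∪
          (goodA.image t ∪ goodA.image t.symm) := by
      intro z hz
      have h3 : ∀ z, t (t z) = t.symm z := fun z => by rw [Equiv.eq_symm_apply, ht]
      have h4 : ∀ z, t.symm (t.symm z) = t z := fun z => by
        rw [Equiv.symm_apply_eq, Equiv.symm_apply_eq, ht]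
      simp only [Finset.mem_union, hbadA, Finset.mem_filter, Finset.mem_sdiff] at hz
      rcases hz with ⟨⟨hzW, hzA⟩, hz⟩ | ⟨hzA, hz⟩
      · by_cases hzbad : t z ∉ W ∨ t.symm z ∉ W
        · exact Finset.mem_union_left _ (Finset.mem_filter.mpr ⟨hzW, hzbad⟩)
        · push Not at hzbad
          refine Finset.mem_union_right _ ?_
          rcases hz with hz | hz
          · have hm : t z ∈ A := by
              by_contra h
              exact hz ⟨hzbad.1, h⟩
            refine Finset.mem_union_right _ (Finset.mem_image.mpr ⟨t z, ?_, t.symm_apply_apply z⟩)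
            exact Finset.mem_filter.mpr
              ⟨hm, by rw [h3]; exact hzbad.2, by rwa [Equiv.symm_apply_apply]⟩
          · have hm : t.symm z ∈ A := by
              by_contra h
              exact hz ⟨hzbad.2, h⟩
            refine Finset.mem_union_left _ (Finset.mem_image.mpr ⟨t.symm z, ?_, t.apply_symm_apply z⟩)
            exact Finset.mem_filter.mpr
              ⟨hm, by rwa [Equiv.apply_symm_apply], by rw [h4]; exact hzbad.1⟩
      · exact Finset.mem_union_left _ (Finset.mem_filter.mpr ⟨hAW hzA, hz⟩)
    have hdisj : Disjoint ((W \ A).filter fun z => t z ∉ W \ A ∨ t.symm z ∉ W \ A) badA :=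
      (Finset.sdiff_disjoint.mono_left (Finset.filter_subset _ _)).mono_right
        (Finset.filter_subset _ _)
    have h1 := Finset.card_le_card hsub
    rw [Finset.card_union_of_disjoint hdisj] at h1
    have h2 := Finset.card_union_le (W.filter fun z => t z ∉ W ∨ t.symm z ∉ W)
      (goodA.image t ∪ goodA.image t.symm)
    have h3 := Finset.card_union_le (goodA.image t) (goodA.image t.symm)
    have h4 := Finset.card_image_le (s := goodA) (f := t)
    have h5 := Finset.card_image_le (s := goodA) (f := t.symm)
    simp only [hbad]
    omega
  have hρA : ρ * A.card ≤ A.card / 2 := by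
    have : (0 : ℝ) ≤ A.card := Nat.cast_nonneg _
    nlinarith
  have key : 8 * small W + 2 * bad W ≤ 8 * small (W \ A) + 2 * bad (W \ A) + A.card := by
    have h1 : cost W ≤ cost (W \ A) + A.card / 2 := hremove.trans (by linarith)
    simp only [hcostdef] at h1
    have h2 : (8 * small W + 2 * bad W : ℝ) ≤ 8 * small (W \ A) + 2 * bad (W \ A) + A.card := by
      linarith
    exact_mod_cast h2
  have hgood : goodA.card ≤ (W.filter fun y => κ y = κ x ∧ t y ∈ W).card := by
    refine Finset.card_le_card fun z hz => ?_
    simp only [hgoodA, hA, Finset.mem_filter] at hz ⊢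
    exact ⟨hz.1.1, hz.1.2, hz.2.1⟩
  split_ifs at hs <;> omega

/-! ### Counting products of three-cycles -/

/-- The elements of `Γ` that move only finitely many points of `X`. -/
def finitaryPart (Γ X : Type*) [Group Γ] [MulAction Γ X] : Subgroup Γ where
  carrier := {γ | {x : X | γ • x ≠ x}.Finite}
  one_mem' := by simp
  mul_mem' := by
    intro γ δ hγ hδ
    refine (Set.Finite.union hγ hδ).subset fun x hx => ?_
    by_contra h
    simp only [Set.mem_union, Set.mem_ofPred_eq, not_or, not_not] at h
    exact hx (by rw [mul_smul, h.2, h.1])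
  inv_mem' := by
    intro γ hγ
    refine Set.Finite.subset hγ fun x hx => ?_
    simp only [Set.mem_ofPred_eq, ne_eq, inv_smul_eq_iff] at hx ⊢
    exact fun h => hx h.symm

/-- An action of `Γ` on `X`, a subgroup `j : H → Γ` acting by left translation on a copy `e` of `H`
in `X`, and an element `t` of `Γ` acting as the three-cycle `(e 1, e a, b)`, where `b` is fixed by
`H`. -/
structure CyclicSwitch {Γ X H : Type*} [Group Γ] [MulAction Γ X] [Group H] (j : H →* Γ)
    (e : H → X) (a : H) (b : X) (t : Γ) : Prop where
  inj : Function.Injective e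
  ne : ∀ h, e h ≠ b
  a_ne : a ≠ 1
  smul_e : ∀ h g, j h • e g = e (h * g)
  smul_b : ∀ h, j h • b = b
  t_one : t • e 1 = e a
  t_a : t • e a = b
  t_b : t • b = e 1
  t_fix : ∀ x, x ≠ e 1 → x ≠ e a → x ≠ b → t • x = x

namespace CyclicSwitch

variable {Γ X H : Type*} [Group Γ] [MulAction Γ X] [Group H] {j : H →* Γ}
  {e : H → X} {a : H} {b : X} {t : Γ}

theorem conj_b (hs : CyclicSwitch j e a b t) (h : H) : (j h * t * (j h)⁻¹) • b = e h := by
  rw [mul_smul, mul_smul, ← map_inv, hs.smul_b, hs.t_b, hs.smul_e, mul_one]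

theorem conj_fix (hs : CyclicSwitch j e a b t) (h y : H) (h1 : y ≠ h) (h2 : y ≠ h * a) :
    (j h * t * (j h)⁻¹) • e y = e y := by
  rw [mul_smul, mul_smul, ← map_inv, hs.smul_e, hs.t_fix, hs.smul_e, mul_inv_cancel_left]
  · rw [hs.inj.ne_iff, ne_eq, inv_mul_eq_iff_eq_mul, mul_one]; exact h1
  · rw [hs.inj.ne_iff, ne_eq, inv_mul_eq_iff_eq_mul]; exact h2
  · exact hs.ne _

theorem t_mem (hs : CyclicSwitch j e a b t) : t ∈ finitaryPart Γ X := by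
  refine Set.Finite.subset (Set.toFinite {e 1, e a, b}) fun x hx => ?_
  by_contra h
  simp only [Set.mem_insert_iff, Set.mem_singleton_iff, not_or] at h
  exact hx (hs.t_fix x h.1 h.2.1 h.2.2)

theorem conj_mem (hs : CyclicSwitch j e a b t) (h : H) :
    j h * t * (j h)⁻¹ ∈ finitaryPart Γ X := by
  have ht : {x : X | t • x ≠ x}.Finite := hs.t_mem
  refine (ht.image (j h • ·)).subset fun x hx => ⟨(j h)⁻¹ • x, ?_, by simp⟩
  simp only [Set.mem_ofPred_eq, mul_smul] at hx ⊢
  contrapose! hx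
  rw [hx, smul_inv_smul]

/-- A nontrivial translation moves all the points of the infinite set `e H`. -/
theorem eq_one_of_mem [Infinite H] (hs : CyclicSwitch j e a b t) {h : H}
    (hh : j h ∈ finitaryPart Γ X) : h = 1 := by
  by_contra hne
  refine (Set.infinite_range_of_injective hs.inj) (Set.Finite.subset hh ?_)
  rintro _ ⟨g, rfl⟩
  simp only [Set.mem_ofPred_eq, hs.smul_e]
  rw [hs.inj.ne_iff]
  simpa using hne

variable [DecidableEq Γ] [DecidableEq H]

/-- Let `W` be a finite subset of `Γ` such that from each of its points `x` there are `m` elements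
`g` of `H` with `g x` and `t g x` in `W`.  Then, up to left multiplication by `H`, the three-cycles
`h t h⁻¹ = (e h, e (h a), b)` can be applied successively to `x₀` with at least `m` choices of `h`
at each step.  Choosing them so that the pairs `{h, h a}` are disjoint, which `Z` keeps track of,
each choice is remembered by the image of the point that was sent to `b` just before. -/
theorem exists_descendants (hs : CyclicSwitch j e a b t) {m : ℕ} {W : Finset Γ}
    (hm : ∀ x ∈ W, ∃ D : Finset H, m ≤ D.card ∧ ∀ g ∈ D, j g * x ∈ W ∧ t * (j g * x) ∈ W)
    (x₀ : Γ) (r : ℕ) :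
    ∀ (π : Γ) (Z : Finset H), (∃ g, j g * (π * x₀) ∈ W) → Z.card + 3 * r ≤ m →
      ∃ D : Finset Γ, r.factorial ≤ D.card ∧ ∀ ρ ∈ D, (∃ g, j g * (ρ * x₀) ∈ W) ∧
        ρ * π⁻¹ ∈ finitaryPart Γ X ∧
        ∀ z y, π • z = e y → y ∈ Z → y * a⁻¹ ∈ Z → ρ • z = e y := by
  induction r with
  | zero =>
    intro π Z hπ _
    refine ⟨{π}, by simp, fun ρ hρ => ?_⟩
    rw [Finset.mem_singleton] at hρ
    subst hρ
    exact ⟨hπ, by simp [one_mem], fun z y h _ _ => h⟩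
  | succ r ih =>
    intro π Z ⟨g₀, hg₀⟩ hZ
    obtain ⟨D, hDm, hD⟩ := hm _ hg₀
    -- the positions of the admissible three-cycles
    set P := (D.image fun g => (g * g₀)⁻¹) \ Z with hP
    have hPcard : r + 1 ≤ P.card := by
      have h1 : (D.image fun g => (g * g₀)⁻¹).card = D.card :=
        Finset.card_image_of_injective _ fun x y hxy => by simpa using hxy
      have h2 := Finset.le_card_sdiff Z (D.image fun g => (g * g₀)⁻¹)
      rw [hP]
      omega
    set c : H → Γ := fun h => j h * t * (j h)⁻¹ with hc
    have hstep : ∀ h ∈ P, ∃ D' : Finset Γ, r.factorial ≤ D'.card ∧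
        ∀ ρ ∈ D', (∃ g, j g * (ρ * x₀) ∈ W) ∧ ρ * (c h * π)⁻¹ ∈ finitaryPart Γ X ∧
          ∀ z y, (c h * π) • z = e y → y ∈ Z ∪ {h, h * a, h * a⁻¹} →
            y * a⁻¹ ∈ Z ∪ {h, h * a, h * a⁻¹} → ρ • z = e y := by
      intro h hh
      refine ih (c h * π) (Z ∪ {h, h * a, h * a⁻¹}) ?_ ?_
      · obtain ⟨g, hg, rfl⟩ := Finset.mem_image.mp (Finset.mem_sdiff.mp hh).1
        refine ⟨g * g₀, ?_⟩
        have := (hD g hg).2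
        simp only [hc, map_mul, map_inv]
        convert this using 1
        group
      · have h1 := Finset.card_union_le Z {h, h * a, h * a⁻¹}
        have h2 : ({h, h * a, h * a⁻¹} : Finset H).card ≤ 3 := Finset.card_le_three
        omega
    choose! D' hD'card hD' using hstep
    have hmark : ∀ h ∈ P, ∀ ρ ∈ D' h, ρ • (π⁻¹ • b) = e h := by
      intro h hh ρ hρ
      refine (hD' h hh ρ hρ).2.2 _ h ?_ (by simp) (by simp)
      rw [mul_smul, smul_inv_smul]
      exact hs.conj_b h
    refine ⟨P.biUnion D', ?_, fun ρ hρ => ?_⟩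
    · rw [Finset.card_biUnion, Nat.factorial_succ]
      · calc (r + 1) * r.factorial ≤ P.card * r.factorial := Nat.mul_le_mul_right _ hPcard
          _ = ∑ _h ∈ P, r.factorial := by simp
          _ ≤ ∑ h ∈ P, (D' h).card := Finset.sum_le_sum hD'card
      · intro h hh h' hh' hne
        rw [Function.onFun, Finset.disjoint_left]
        intro ρ h1 h2
        exact hne (hs.inj ((hmark h hh ρ h1).symm.trans (hmark h' hh' ρ h2)))
    · obtain ⟨h, hh, hρh⟩ := Finset.mem_biUnion.mp hρ
      obtain ⟨h1, h2, h3⟩ := hD' h hh ρ hρh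
      have hhZ : h ∉ Z := (Finset.mem_sdiff.mp hh).2
      refine ⟨h1, ?_, fun z y hz hy hya => h3 z y ?_ (Finset.mem_union_left _ hy)
        (Finset.mem_union_left _ hya)⟩
      · have := mul_mem h2 (hs.conj_mem h)
        rwa [mul_inv_rev, mul_assoc, inv_mul_cancel_right] at this
      · rw [mul_smul, hz]
        refine hs.conj_fix h y (fun h' => hhZ (h' ▸ hy)) (fun h' => hhZ ?_)
        rwa [h', mul_inv_cancel_right] at hya

theorem factorial_le_card [Infinite H] (hs : CyclicSwitch j e a b t) {m r : ℕ} {W : Finset Γ}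
    (hW : W.Nonempty) (hr : 3 * r ≤ m)
    (hm : ∀ x ∈ W, ∃ D : Finset H, m ≤ D.card ∧ ∀ g ∈ D, j g * x ∈ W ∧ t * (j g * x) ∈ W) :
    r.factorial ≤ W.card := by
  obtain ⟨x₀, hx₀⟩ := hW
  obtain ⟨D, hDcard, hD⟩ := hs.exists_descendants hm x₀ r 1 ∅ ⟨1, by simpa using hx₀⟩ (by simpa)
  have h1 : ∀ ρ ∈ D, ∃ g, j g * (ρ * x₀) ∈ W := fun ρ hρ => (hD ρ hρ).1
  choose! g hg using h1
  refine hDcard.trans (Finset.card_le_card_of_injOn (fun ρ => j (g ρ) * (ρ * x₀)) hg ?_)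
  -- distinct finitary elements lie in distinct cosets of `H`
  intro ρ hρ ρ' hρ' heq
  simp only [← mul_assoc, mul_left_inj] at heq
  have hfin : ∀ ρ ∈ D, ρ ∈ finitaryPart Γ X := fun ρ hρ => by simpa using (hD ρ hρ).2.1
  have hj : j ((g ρ')⁻¹ * g ρ) = ρ' * ρ⁻¹ := by
    rw [map_mul, map_inv, inv_mul_eq_iff_eq_mul, ← mul_assoc, ← heq, mul_inv_cancel_right]
  have h1 : (g ρ')⁻¹ * g ρ = 1 :=
    hs.eq_one_of_mem (by rw [hj]; exact mul_mem (hfin _ hρ') (inv_mem (hfin _ hρ)))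
  rw [h1, map_one] at hj
  exact (mul_inv_eq_one.mp hj.symm).symm

end CyclicSwitch

/-! ### The energy along a subgroup -/

theorem ofReal_sum_pow_eq_tsum {α : Type*} {p : ℕ} (hp : p ≠ 0) {Ω : Finset α} {f : α → ℝ}
    (hf : Function.support f ⊆ (Ω : Set α)) :
    ENNReal.ofReal (∑ x ∈ Ω, |f x| ^ p) = ∑' x, ENNReal.ofReal (|f x| ^ p) := by
  rw [ENNReal.ofReal_sum_of_nonneg fun _ _ => by positivity, tsum_eq_sum]
  intro x hx
  have : f x = 0 := by
    by_contra h
    exact hx (hf h)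
  simp [this, hp]

section Along

variable {Γ H : Type*} [Group Γ] [Group H] (j : H →* Γ) (p : ℕ)

/-- The energy of a function on `Γ` with respect to the image of `φ` under `j : H → Γ`. -/
noncomputable def energyAlong (φ : H → ℝ≥0∞) (f : Γ → ℝ) : ℝ≥0∞ :=
  2⁻¹ * ∑' x, ∑' g, ENNReal.ofReal (|f (j g * x) - f x| ^ p) * φ g

/-- The `p`-th power of the `ℓ^p`-distance from `f` to its left translate by `γ`. -/
noncomputable def shiftCost (f : Γ → ℝ) (γ : Γ) : ℝ≥0∞ :=
  ∑' x, ENNReal.ofReal (|f (γ * x) - f x| ^ p)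

variable {j p}

theorem energyAlong_mono_of_abs_le {φ : H → ℝ≥0∞} {f h : Γ → ℝ}
    (hfh : ∀ x y, |h (j y * x) - h x| ≤ |f (j y * x) - f x|) :
    energyAlong j p φ h ≤ energyAlong j p φ f := by
  unfold energyAlong
  refine mul_le_mul_right (ENNReal.tsum_le_tsum fun x => ENNReal.tsum_le_tsum fun y => ?_) _
  exact mul_le_mul_left (ENNReal.ofReal_le_ofReal (pow_le_pow_left₀ (abs_nonneg _) (hfh x y) p)) _

theorem energyAlong_eq_tsum (φ : H → ℝ≥0∞) (f : Γ → ℝ) :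
    energyAlong j p φ f = 2⁻¹ * ∑' g, shiftCost p f (j g) * φ g := by
  simp only [energyAlong, shiftCost, ← ENNReal.tsum_mul_right]
  rw [ENNReal.tsum_comm]

theorem shiftCost_mul_le {φ : H → ℝ≥0∞} (f : Γ → ℝ) (g : H) :
    shiftCost p f (j g) * φ g ≤ 2 * energyAlong j p φ f := by
  rw [energyAlong_eq_tsum, ← mul_assoc, ENNReal.mul_inv_cancel (by simp) (by simp), one_mul]
  exact ENNReal.le_tsum g

theorem shiftCost_inv (f : Γ → ℝ) (γ : Γ) : shiftCost p f γ⁻¹ = shiftCost p f γ := by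
  unfold shiftCost
  rw [← (Equiv.mulLeft γ).tsum_eq]
  simp [abs_sub_comm]

theorem abs_add_pow_le (hp : p = 1 ∨ p = 2) (u v : ℝ) :
    |u + v| ^ p ≤ 2 * (|u| ^ p + |v| ^ p) := by
  rcases hp with rfl | rfl
  · have := abs_add_le u v
    have h1 := abs_nonneg u
    have h2 := abs_nonneg v
    simp only [pow_one]
    linarith
  · simp only [sq_abs]
    nlinarith [sq_nonneg (u - v)]

theorem shiftCost_mul (hp : p = 1 ∨ p = 2) (f : Γ → ℝ) (γ δ : Γ) :
    shiftCost p f (γ * δ) ≤ 2 * (shiftCost p f γ + shiftCost p f δ) := by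
  have h : shiftCost p f γ = ∑' x, ENNReal.ofReal (|f (γ * (δ * x)) - f (δ * x)| ^ p) :=
    ((Equiv.mulLeft δ).tsum_eq fun x => ENNReal.ofReal (|f (γ * x) - f x| ^ p)).symm
  rw [h]
  unfold shiftCost
  rw [← ENNReal.tsum_add, ← ENNReal.tsum_mul_left]
  refine ENNReal.tsum_le_tsum fun x => ?_
  rw [← ENNReal.ofReal_add (by positivity) (by positivity),
    show (2 : ℝ≥0∞) = ENNReal.ofReal 2 by simp, ← ENNReal.ofReal_mul (by norm_num)]
  refine ENNReal.ofReal_le_ofReal ?_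
  have := abs_add_pow_le hp (f (γ * (δ * x)) - f (δ * x)) (f (δ * x) - f x)
  rw [sub_add_sub_cancel] at this
  rwa [mul_assoc]

theorem shiftCost_commutator_le (hp : p = 1 ∨ p = 2) (f : Γ → ℝ) (γ δ : Γ) :
    shiftCost p f (γ * δ * (γ⁻¹ * δ⁻¹)) ≤ 8 * (shiftCost p f γ + shiftCost p f δ) := by
  calc _ ≤ 2 * (shiftCost p f (γ * δ) + shiftCost p f (γ⁻¹ * δ⁻¹)) := shiftCost_mul hp f _ _
    _ ≤ 2 * (2 * (shiftCost p f γ + shiftCost p f δ) +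
        2 * (shiftCost p f γ⁻¹ + shiftCost p f δ⁻¹)) := by
      gcongr <;> exact shiftCost_mul hp f _ _
    _ = 8 * (shiftCost p f γ + shiftCost p f δ) := by
      rw [shiftCost_inv, shiftCost_inv]; ring

theorem tsum_mul_map {α β : Type*} (φ : PMF α) (i : α → β) (F : β → ℝ≥0∞) :
    ∑' y, F y * φ.map i y = ∑' x, F (i x) * φ x := by
  classical
  simp_rw [PMF.map_apply, ← ENNReal.tsum_mul_left]
  rw [ENNReal.tsum_comm]
  refine tsum_congr fun x => ?_
  rw [tsum_eq_single (i x)]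
  · simp
  · intro y hy
    simp [hy]

theorem energy_map (φ : PMF H) (f : Γ → ℝ) :
    energy p (φ.map j) f = energyAlong j p φ f := by
  simp only [energy, energyAlong, tsum_mul_map]

open Classical in
/-- Decomposition of the energy along the cosets of `H`: on functions whose support meets each coset
in fewer than `N` points, the energy is bounded below by the profile of `H` below `N`. -/
theorem mul_sum_le_energyAlong (hp : p ≠ 0) (hj : Function.Injective j) {φ : H → ℝ≥0∞} {N : ℕ}
    {s : ℝ≥0∞} (hs : ∀ k : ℕ, k < N → s ≤ profile p φ k) {Ω : Finset Γ} {h : Γ → ℝ}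
    (hh : Function.support h ⊆ (Ω : Set Γ))
    (hN : ∀ q : Quotient (QuotientGroup.rightRel j.range),
      (Ω.filter fun y => Quotient.mk _ y = q ∧ h y ≠ 0).card < N) :
    s * ENNReal.ofReal (∑ x ∈ Ω, |h x| ^ p) ≤ energyAlong j p φ h := by
  set F : Quotient (QuotientGroup.rightRel j.range) × H → Γ := fun z => j z.2 * z.1.out with hF
  have hmk : ∀ q : Quotient (QuotientGroup.rightRel j.range), ∀ g,
      (Quotient.mk (QuotientGroup.rightRel j.range) (j g * q.out)) = q := by
    intro q g
    conv_rhs => rw [← q.out_eq]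
    refine Quotient.sound ?_
    change QuotientGroup.rightRel j.range _ _
    rw [QuotientGroup.rightRel_apply]
    exact ⟨g⁻¹, by simp⟩
  have hFbij : Function.Bijective F := by
    constructor
    · rintro ⟨q, g⟩ ⟨q', g'⟩ heq
      have h1 : q = q' := by rw [← hmk q g, ← hmk q' g']; exact congrArg _ heq
      subst h1
      simpa [hF, hj.eq_iff] using heq
    · intro x
      have h1 : QuotientGroup.rightRel j.range (Quotient.mk _ x).out x := Quotient.mk_out x
      rw [QuotientGroup.rightRel_apply] at h1
      obtain ⟨g, hg⟩ := h1
      exact ⟨(Quotient.mk _ x, g), by simp [hF, hg]⟩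
  set e := Equiv.ofBijective F hFbij with he
  have hdecomp : ∀ T : Γ → ℝ≥0∞, ∑' x, T x = ∑' q, ∑' g, T (F (q, g)) := by
    intro T
    rw [← e.tsum_eq, ENNReal.tsum_prod']
    rfl
  have hE : energyAlong j p φ h = ∑' q, energy p φ (fun g => h (F (q, g))) := by
    unfold energyAlong energy
    rw [hdecomp, ENNReal.tsum_mul_left]
    simp only [hF, map_mul, mul_assoc]
  rw [hE, ofReal_sum_pow_eq_tsum hp hh, hdecomp, ← ENNReal.tsum_mul_left]
  refine ENNReal.tsum_le_tsum fun q => ?_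
  have hinj : Function.Injective fun g => F (q, g) := fun g g' hg => by
    simpa using hFbij.1 hg
  set B : Finset H := (Ω.filter fun y => h y ≠ 0).preimage (fun g => F (q, g)) hinj.injOn with hB
  have hBcard : B.card < N := by
    refine lt_of_le_of_lt ?_ (hN q)
    refine Finset.card_le_card_of_injOn _ (fun g hg => ?_) hinj.injOn
    simp only [hB, Finset.coe_preimage, Set.mem_preimage, Finset.mem_coe, Finset.mem_filter] at hg ⊢
    exact ⟨hg.1, hmk q g, hg.2⟩
  have hBsupp : Function.support (fun g => h (F (q, g))) ⊆ (B : Set H) := by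
    intro g hg
    simp only [hB, Finset.coe_preimage, Set.mem_preimage, Finset.mem_coe, Finset.mem_filter]
    exact ⟨hh hg, hg⟩
  rw [← ofReal_sum_pow_eq_tsum hp hBsupp]
  exact (mul_le_mul_left (hs _ hBcard) _).trans (profile_mul_le_energy hp φ le_rfl hBsupp)

end Along

/-! ### Supports of functions of small energy -/

open Classical in
/-- A function on `Γ` of small energy along `H` and nearly invariant under `t` has a large support.
Some level set of `|f| ^ p` meets most of its cosets of `H` in at least `N` points and is nearly
invariant under `t`; its thick part is large by `CyclicSwitch.factorial_le_card`. -/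
theorem factorial_le_card_of_energyAlong_le {Γ X H : Type*} [Group Γ] [MulAction Γ X] [Group H]
    [Infinite H] {j : H →* Γ} {e : H → X} {a : H} {b : X} {t : Γ} (hsw : CyclicSwitch j e a b t)
    (ht : t * t * t = 1) {p : ℕ} (hp : p = 1 ∨ p = 2) {φ : H → ℝ≥0∞} {N : ℕ} (hN : 1 ≤ N)
    {s : ℝ≥0∞} (hs0 : s ≠ 0) (hs1 : s ≠ ∞) (hs : ∀ k : ℕ, k < N → s ≤ profile p φ k)
    {Ω : Finset Γ} {f : Γ → ℝ} (hf : Function.support f ⊆ (Ω : Set Γ))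
    (hf1 : ∑ x ∈ Ω, |f x| ^ p = 1)
    (hE : energyAlong j p φ f ≤ s * ENNReal.ofReal (1 / 4096))
    (hD : shiftCost p f t ≤ ENNReal.ofReal (1 / 4096)) :
    (N / 18).factorial ≤ Ω.card := by
  have hp0 : p ≠ 0 := by rcases hp with rfl | rfl <;> simp
  have hj : Function.Injective j := by
    rw [injective_iff_map_eq_one]
    intro h hh
    exact hsw.eq_one_of_mem (by rw [hh]; exact one_mem _)
  set κ : Γ → Quotient (QuotientGroup.rightRel j.range) := fun x => Quotient.mk _ x with hκ
  have hκeq : ∀ x y, κ y = κ x ↔ ∃ g, y = j g * x := by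
    intro x y
    rw [eq_comm, hκ]
    simp only
    rw [Quotient.eq, QuotientGroup.rightRel_apply]
    constructor
    · rintro ⟨g, hg⟩
      exact ⟨g, by rw [hg, inv_mul_cancel_right]⟩
    · rintro ⟨g, rfl⟩
      exact ⟨g, by rw [mul_inv_cancel_right]⟩
  -- the `N`-th largest value of `|f|` on each coset
  have hlevel : ∀ q, ∃ τ : ℝ, 0 ≤ τ ∧ (Ω.filter fun y => κ y = q ∧ τ < |f y|).card < N ∧
      (0 < τ → N ≤ (Ω.filter fun y => κ y = q ∧ τ ≤ |f y|).card) := by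
    intro q
    by_cases hq : N ≤ (Ω.filter fun y => κ y = q).card
    · obtain ⟨x, -, h1, h2⟩ := exists_level _ (fun y => |f y|) hN hq
      rw [Finset.filter_filter] at h1 h2
      exact ⟨|f x|, abs_nonneg _, h1, fun _ => h2⟩
    · refine ⟨0, le_rfl, lt_of_le_of_lt (Finset.card_le_card fun y hy => ?_) (not_le.mp hq),
        fun h => absurd h (lt_irrefl _)⟩
      simp only [Finset.mem_filter] at hy ⊢
      exact ⟨hy.1, hy.2.1⟩
  choose τ hτ0 hτN hτN' using hlevel
  have hfΩ : ∀ x, x ∉ Ω → f x = 0 := fun x hx => by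
    by_contra h
    exact hx (hf h)
  -- the part of `f` above that value
  set h : Γ → ℝ := fun x => max (|f x| - τ (κ x)) 0 with hh
  have hh0 : ∀ x, 0 ≤ h x := fun x => le_max_right _ _
  have hhpos : ∀ x, h x ≠ 0 → τ (κ x) < |f x| := by
    intro x hx
    by_contra hle
    exact hx (max_eq_right (by linarith))
  have hhsupp : Function.support h ⊆ (Ω : Set Γ) := by
    intro x hx
    refine hf fun h0 => ?_
    have := hhpos x hx
    rw [h0, abs_zero] at this
    exact absurd this (not_lt.mpr (hτ0 _))
  have hhE : energyAlong j p φ h ≤ energyAlong j p φ f := by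
    refine energyAlong_mono_of_abs_le fun x y => ?_
    have h1 : κ (j y * x) = κ x := (hκeq _ _).mpr ⟨y, rfl⟩
    simp only [hh, h1]
    calc _ ≤ |(|f (j y * x)| - τ (κ x)) - (|f x| - τ (κ x))| := abs_max_sub_max_le_abs _ _ _
      _ = |(|f (j y * x)| - |f x|)| := by rw [sub_sub_sub_cancel_right]
      _ ≤ _ := abs_abs_sub_abs_le _ _
  have hsum1 : ∑ x ∈ Ω, h x ^ p ≤ 1 / 4096 := by
    have h1 := mul_sum_le_energyAlong hp0 hj hs hhsupp (fun q => by
      refine lt_of_le_of_lt (Finset.card_le_card fun y hy => ?_) (hτN q)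
      simp only [Finset.mem_filter] at hy ⊢
      obtain ⟨hy1, hy2, hy3⟩ := hy
      refine ⟨hy1, hy2, ?_⟩
      have := hhpos y hy3
      rwa [show κ y = q from hy2] at this)
    have h2 := h1.trans (hhE.trans hE)
    rw [ENNReal.mul_le_mul_iff_right hs0 hs1, ENNReal.ofReal_le_ofReal_iff (by norm_num)] at h2
    simpa only [abs_of_nonneg (hh0 _)] using h2
  have hsum2 : ∀ γ, shiftCost p f γ ≤ ENNReal.ofReal (1 / 4096) →
      ∑ x ∈ Ω, max (|f x| - |f (γ * x)|) 0 ^ p ≤ 1 / 4096 := by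
    intro γ hγ
    have h1 := (ENNReal.sum_le_tsum Ω).trans hγ
    rw [← ENNReal.ofReal_sum_of_nonneg fun _ _ => by positivity,
      ENNReal.ofReal_le_ofReal_iff (by norm_num)] at h1
    refine (Finset.sum_le_sum fun x _ => ?_).trans h1
    refine pow_le_pow_left₀ (le_max_right _ _) (max_le ?_ (abs_nonneg _)) p
    rw [abs_sub_comm]
    exact abs_sub_abs_le_abs_sub _ _
  have hmax : ∀ τ : Γ → ℝ, ∑ x ∈ Ω, max (|f x| - τ x) 0 ^ p ≤ 1 / 4096 →
      ∑ x ∈ Ω, max (|f x| ^ p - τ x ^ p) 0 ≤ 32 * (1 / 4096) + 1 / 32 := by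
    intro τ hτ
    calc ∑ x ∈ Ω, max (|f x| ^ p - τ x ^ p) 0
        ≤ ∑ x ∈ Ω, (32 * max (|f x| - τ x) 0 ^ p + |f x| ^ p / 32) := by
          refine Finset.sum_le_sum fun x _ => max_le ?_ (by positivity)
          exact pow_sub_pow_le hp (by norm_num) (abs_nonneg _)
      _ = 32 * ∑ x ∈ Ω, max (|f x| - τ x) 0 ^ p + (∑ x ∈ Ω, |f x| ^ p) / 32 := by
          rw [Finset.sum_add_distrib, Finset.mul_sum, Finset.sum_div]
      _ ≤ _ := by rw [hf1]; linarith
  obtain ⟨σ, hσ0, hσ⟩ := exists_level_set Ω (fun x => |f x| ^ p) (fun x => τ (κ x) ^ p)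
    (fun x => |f (t * x)| ^ p) (fun x => |f (t⁻¹ * x)| ^ p) (δ := 1 / 8) (by norm_num)
    (fun x _ => by positivity) (by
      have h1 := hmax (fun x => τ (κ x)) hsum1
      have h2 := hmax (fun x => |f (t * x)|) (hsum2 t hD)
      have h3 := hmax (fun x => |f (t⁻¹ * x)|) (hsum2 t⁻¹ (by rwa [shiftCost_inv]))
      simp only [hf1]
      linarith)
  set U := Ω.filter fun x => σ < |f x| ^ p with hU
  have hUmem : ∀ x, x ∉ U → |f x| ^ p ≤ σ := by
    intro x hx
    by_cases hxΩ : x ∈ Ω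
    · simpa [hU, hxΩ] using hx
    · simpa [hfΩ x hxΩ, hp0] using hσ0
  have hUne : U.Nonempty := by
    rw [Finset.nonempty_iff_ne_empty]
    intro h0
    rw [h0] at hσ
    simp only [Finset.card_empty, Nat.cast_zero, mul_zero] at hσ
    exact absurd hσ (not_lt.mpr (by positivity))
  have hsmall : (U.filter fun x => (U.filter fun y => κ y = κ x).card < N).card ≤
      (Ω.filter fun x => τ (κ x) ^ p ≤ σ ∧ σ < |f x| ^ p).card := by
    refine Finset.card_le_card fun x hx => ?_
    simp only [hU, Finset.mem_filter] at hx ⊢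
    obtain ⟨⟨hxΩ, hxσ⟩, hxN⟩ := hx
    refine ⟨hxΩ, ?_, hxσ⟩
    by_contra! hlt
    have hτpos : 0 < τ (κ x) := by
      rcases (hτ0 (κ x)).eq_or_lt with h0 | h0
      · rw [← h0, zero_pow hp0] at hlt
        exact absurd hlt (not_lt.mpr hσ0)
      · exact h0
    refine absurd hxN (not_lt.mpr ((hτN' _ hτpos).trans (Finset.card_le_card fun y hy => ?_)))
    simp only [Finset.mem_filter] at hy ⊢
    exact ⟨⟨hy.1, hlt.trans_le (pow_le_pow_left₀ (hτ0 _) hy.2.2 p)⟩, hy.2.1⟩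
  have hbad : (U.filter fun x => Equiv.mulLeft t x ∉ U ∨ (Equiv.mulLeft t).symm x ∉ U).card ≤
      (Ω.filter fun x => |f (t * x)| ^ p ≤ σ ∧ σ < |f x| ^ p).card +
      (Ω.filter fun x => |f (t⁻¹ * x)| ^ p ≤ σ ∧ σ < |f x| ^ p).card := by
    refine (Finset.card_le_card fun x hx => ?_).trans (Finset.card_union_le _ _)
    simp only [Finset.mem_filter, Equiv.coe_mulLeft, Equiv.mulLeft_symm, Finset.mem_union] at hx ⊢
    have hxU := Finset.mem_filter.mp hx.1
    rcases hx.2 with h1 | h1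
    · exact Or.inl ⟨hxU.1, hUmem _ h1, hxU.2⟩
    · exact Or.inr ⟨hxU.1, hUmem _ h1, hxU.2⟩
  obtain ⟨W, hWU, hWne, hW⟩ := exists_thick_subset κ (Equiv.mulLeft t)
    (fun x => by simp [← mul_assoc, ht]) N U hUne (by
      have h1 : 8 * ((Ω.filter fun x => τ (κ x) ^ p ≤ σ ∧ σ < |f x| ^ p).card +
          (Ω.filter fun x => |f (t * x)| ^ p ≤ σ ∧ σ < |f x| ^ p).card +
          (Ω.filter fun x => |f (t⁻¹ * x)| ^ p ≤ σ ∧ σ < |f x| ^ p).card) ≤ U.card := by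
        have : (8 * (((Ω.filter fun x => τ (κ x) ^ p ≤ σ ∧ σ < |f x| ^ p).card : ℝ) +
          (Ω.filter fun x => |f (t * x)| ^ p ≤ σ ∧ σ < |f x| ^ p).card +
          (Ω.filter fun x => |f (t⁻¹ * x)| ^ p ≤ σ ∧ σ < |f x| ^ p).card) : ℝ) ≤ U.card := by
          linarith
        exact_mod_cast this
      omega)
  refine le_trans ?_ (Finset.card_le_card (hWU.trans (Finset.filter_subset _ _)))
  refine hsw.factorial_le_card (m := (N + 5) / 6) hWne (by omega) fun x hx => ?_
  have hinj : Function.Injective fun g => j g * x := fun g g' hg => hj (mul_right_cancel hg)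
  refine ⟨(W.filter fun y => κ y = κ x ∧ t * y ∈ W).preimage (fun g => j g * x) hinj.injOn,
    ?_, fun g hg => ?_⟩
  · have h1 : N ≤ 6 * (W.filter fun y => κ y = κ x ∧ t * y ∈ W).card := by
      convert hW x hx
      rfl
    have h2 : (W.filter fun y => κ y = κ x ∧ t * y ∈ W).card ≤
        ((W.filter fun y => κ y = κ x ∧ t * y ∈ W).preimage (fun g => j g * x)
          hinj.injOn).card := by
      refine Finset.card_le_card_of_surjOn (fun g => j g * x) fun y hy => ?_
      obtain ⟨g, rfl⟩ := (hκeq _ _).mp (Finset.mem_filter.mp hy).2.1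
      exact ⟨g, Finset.mem_preimage.mpr hy, rfl⟩
    omega
  · have := Finset.mem_filter.mp (Finset.mem_preimage.mp hg)
    exact ⟨this.1, this.2.2⟩

/-! ### The profile of an infinite group does not drop abruptly -/

section Doubling

variable {G : Type u} [Group G] [DecidableEq G]

/-- In an infinite group, a nearly invariant finite set `Ω` has a left translate `z Ω` that meets
`Ω` in nearly half of its points: along the generators `|Ω ∩ z Ω|` changes slowly, from `|Ω|` at
`z = 1` to `0` outside a finite set. -/
theorem exists_half_translate [Infinite G] (Ω : Finset G) (hΩ : Ω.Nonempty) (T : Set G)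
    (hT : Subgroup.closure T = ⊤) (hTinv : ∀ s ∈ T, s⁻¹ ∈ T) (d : ℕ)
    (hd : ∀ s ∈ T, (Ω.filter fun x => s * x ∉ Ω).card ≤ d) :
    ∃ z : G, 2 * (Ω.filter fun x => z⁻¹ * x ∈ Ω).card ≤ Ω.card ∧
      Ω.card ≤ 2 * ((Ω.filter fun x => z⁻¹ * x ∈ Ω).card + d) := by
  set n : G → ℕ := fun z => (Ω.filter fun x => z⁻¹ * x ∈ Ω).card with hn
  by_contra! hcon
  have hcpos := hΩ.card_pos
  have hstep : ∀ z, ∀ s ∈ T, n z ≤ n (z * s) + d := by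
    intro z s hs
    have hsub : (Ω.filter fun x => z⁻¹ * x ∈ Ω) ⊆ (Ω.filter fun x => (z * s)⁻¹ * x ∈ Ω) ∪
        ((Ω.filter fun x => s⁻¹ * x ∉ Ω).image fun x => z * x) := by
      intro x hx
      obtain ⟨hx1, hx2⟩ := Finset.mem_filter.mp hx
      by_cases h : (z * s)⁻¹ * x ∈ Ω
      · exact Finset.mem_union_left _ (Finset.mem_filter.mpr ⟨hx1, h⟩)
      · refine Finset.mem_union_right _ (Finset.mem_image.mpr ⟨z⁻¹ * x, ?_, by simp⟩)
        refine Finset.mem_filter.mpr ⟨hx2, ?_⟩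
        rwa [mul_inv_rev, mul_assoc] at h
    have h1 := (Finset.card_le_card hsub).trans (Finset.card_union_le _ _)
    have h2 := Finset.card_image_le (s := Ω.filter fun x => s⁻¹ * x ∉ Ω) (f := fun x => z * x)
    have h3 := hd s⁻¹ (hTinv s hs)
    simp only [hn]
    omega
  have hall : ∀ z : G, Ω.card < 2 * n z := by
    intro z
    have hz : z ∈ Subgroup.closure T := by rw [hT]; trivial
    induction hz using Subgroup.closure_induction_right with
    | one => simp only [hn]; simp; omega
    | mul_right x hx y hy ih =>
      have h1 := hstep x y hy
      by_contra! h
      have := hcon (x * y) h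
      simp only [hn] at *
      omega
    | mul_inv_cancel x hx y hy ih =>
      have h1 := hstep x y⁻¹ (hTinv y hy)
      by_contra! h
      have := hcon (x * y⁻¹) h
      simp only [hn] at *
      omega
  obtain ⟨z, hz⟩ := Infinite.exists_notMem_finset (Finset.image₂ (fun x y => x * y⁻¹) Ω Ω)
  have := hall z
  have h0 : n z = 0 := by
    simp only [hn, Finset.card_eq_zero, Finset.filter_eq_empty_iff]
    intro x hx h
    exact hz (Finset.mem_image₂.mpr ⟨x, hx, _, h, by simp⟩)
  omega

/-- Double counting of the pairs `(x, y)` in `A × A` for which `Ω` and its right translate by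
`x⁻¹ * y` have a small intersection. -/
theorem card_pairs_le (Ω A : Finset G) (hA : A ⊆ Ω) (z : G) (v : ℝ) (hv : 0 < v) {θ : ℝ}
    (hθ0 : 0 < θ) (hθ : θ ≤ 1 / 32) (hΩv : (Ω.card : ℝ) ≤ (1 + θ) * v)
    (hAv : v ≤ (A.card : ℝ))
    (hz1 : 2 * ((Ω.filter fun x => z⁻¹ * x ∈ Ω).card : ℝ) ≤ Ω.card)
    (hz2 : (Ω.card : ℝ) ≤ 2 * ((Ω.filter fun x => z⁻¹ * x ∈ Ω).card + 2 * θ * Ω.card)) :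
    (Ω.card : ℝ) ^ 2 / 16 ≤ ((A ×ˢ A).filter fun w =>
      ((Ω.filter fun x => x * (w.1⁻¹ * w.2) ∈ Ω).card : ℝ) ≤ v).card := by
  set P := Ω.filter fun x => z⁻¹ * x ∈ Ω with hP
  set Q := Ω.filter fun x => ¬ z⁻¹ * x ∈ Ω with hQ
  set good := (A ×ˢ A).filter fun w =>
      ((Ω.filter fun x => x * (w.1⁻¹ * w.2) ∈ Ω).card : ℝ) ≤ v with hgood
  set B := (Finset.image₂ (fun x y => x⁻¹ * y) Ω Ω).filter fun g =>
    v < ((Ω.filter fun x => x * g ∈ Ω).card : ℝ) with hB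
  have hPQ : (P.card : ℝ) + Q.card = Ω.card := by
    exact_mod_cast Finset.card_filter_add_card_filter_not (s := Ω) fun x => z⁻¹ * x ∈ Ω
  set m : ℝ := (Ω.card : ℝ) with hm
  have hm0 : 0 < m := hv.trans_le (hAv.trans (by rw [hm]; exact_mod_cast Finset.card_le_card hA))
  -- there are few elements `g` with a large intersection
  have hBcard : (B.card : ℝ) ≤ (1 + θ) * m := by
    have h1 : ∑ g ∈ B, (Ω.filter fun x => x * g ∈ Ω).card ≤ (Ω ×ˢ Ω).card := by
      calc ∑ g ∈ B, (Ω.filter fun x => x * g ∈ Ω).card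
          ≤ ∑ g ∈ B, ((Ω ×ˢ Ω).filter fun w => w.1⁻¹ * w.2 = g).card := by
            refine Finset.sum_le_sum fun g _ => ?_
            refine Finset.card_le_card_of_injOn (fun x => (x, x * g)) (fun x hx => ?_)
              (fun x _ y _ hxy => (Prod.ext_iff.mp hxy).1)
            have := Finset.mem_filter.mp hx
            simp [this.1, this.2]
        _ ≤ (Ω ×ˢ Ω).card := by
            rw [← Finset.card_biUnion]
            · exact Finset.card_le_card (Finset.biUnion_subset.mpr fun g _ =>
                Finset.filter_subset _ _)
            · intro g _ g' _ hne
              rw [Function.onFun, Finset.disjoint_left]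
              intro w h1 h2
              exact hne ((Finset.mem_filter.mp h1).2.symm.trans (Finset.mem_filter.mp h2).2)
    have h2 : (B.card : ℝ) * v ≤ m * m := by
      have h3 : (B.card : ℝ) * v ≤ ∑ g ∈ B, ((Ω.filter fun x => x * g ∈ Ω).card : ℝ) := by
        rw [← nsmul_eq_mul]
        exact Finset.card_nsmul_le_sum _ _ _ fun g hg => (Finset.mem_filter.mp hg).2.le
      rw [Finset.card_product] at h1
      refine h3.trans ?_
      rw [hm]
      exact_mod_cast h1
    have h4 : (B.card : ℝ) * v ≤ (1 + θ) * m * v := by nlinarith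
    exact le_of_mul_le_mul_right h4 hv
  -- the pairs in `P × Q` at such a `g` are few
  have hsub : P ×ˢ Q ⊆ good ∪ (B.biUnion fun g =>
      (Ω.filter fun x => ¬ x * g ∈ Ω).image fun x => (z * x, z * (x * g))) ∪
      ((Ω \ A) ×ˢ Ω ∪ Ω ×ˢ (Ω \ A)) := by
    rintro ⟨x, y⟩ hxy
    rw [Finset.mem_product] at hxy
    obtain ⟨hx1, hx2⟩ := Finset.mem_filter.mp hxy.1
    obtain ⟨hy1, hy2⟩ := Finset.mem_filter.mp hxy.2
    by_cases hxA : x ∈ A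
    · by_cases hyA : y ∈ A
      · refine Finset.mem_union_left _ ?_
        by_cases hg : ((Ω.filter fun w => w * (x⁻¹ * y) ∈ Ω).card : ℝ) ≤ v
        · exact Finset.mem_union_left _ (Finset.mem_filter.mpr
            ⟨Finset.mem_product.mpr ⟨hxA, hyA⟩, hg⟩)
        · refine Finset.mem_union_right _ (Finset.mem_biUnion.mpr ⟨x⁻¹ * y, ?_, ?_⟩)
          · exact Finset.mem_filter.mpr ⟨Finset.mem_image₂.mpr ⟨x, hx1, y, hy1, rfl⟩,
              not_le.mp hg⟩
          · refine Finset.mem_image.mpr ⟨z⁻¹ * x, Finset.mem_filter.mpr ⟨hx2, ?_⟩, ?_⟩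
            · rwa [mul_assoc, mul_inv_cancel_left]
            · simp [mul_assoc]
      · exact Finset.mem_union_right _ (Finset.mem_union_right _
          (Finset.mem_product.mpr ⟨hx1, Finset.mem_sdiff.mpr ⟨hy1, hyA⟩⟩))
    · exact Finset.mem_union_right _ (Finset.mem_union_left _
        (Finset.mem_product.mpr ⟨Finset.mem_sdiff.mpr ⟨hx1, hxA⟩, hy1⟩))
  have hc1 : ((B.biUnion fun g =>
      (Ω.filter fun x => ¬ x * g ∈ Ω).image fun x => (z * x, z * (x * g))).card : ℝ) ≤
      (1 + θ) * m * (θ * m) := by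
    have h1 : ∀ g ∈ B, (((Ω.filter fun x => ¬ x * g ∈ Ω).image
        fun x => (z * x, z * (x * g))).card : ℝ) ≤ θ * m := by
      intro g hg
      have h2 : (((Ω.filter fun x => ¬ x * g ∈ Ω).image
        fun x => (z * x, z * (x * g))).card : ℝ) ≤ (Ω.filter fun x => ¬ x * g ∈ Ω).card := by
        exact_mod_cast Finset.card_image_le
      have h3 : ((Ω.filter fun x => x * g ∈ Ω).card : ℝ) +
          (Ω.filter fun x => ¬ x * g ∈ Ω).card = Ω.card := by
        exact_mod_cast Finset.card_filter_add_card_filter_not (s := Ω) fun x => x * g ∈ Ω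
      have h4 := (Finset.mem_filter.mp hg).2
      have h5 : m - v ≤ θ * m := by nlinarith [mul_pos hθ0 hθ0, mul_pos hθ0 hv]
      linarith
    calc _ ≤ ∑ g ∈ B, (((Ω.filter fun x => ¬ x * g ∈ Ω).image
        fun x => (z * x, z * (x * g))).card : ℝ) := by exact_mod_cast Finset.card_biUnion_le
      _ ≤ ∑ _g ∈ B, θ * m := Finset.sum_le_sum h1
      _ = B.card * (θ * m) := by simp
      _ ≤ _ := by gcongr
  have hΩA : ((Ω \ A).card : ℝ) ≤ θ * m := by
    rw [Finset.card_sdiff_of_subset hA, Nat.cast_sub (Finset.card_le_card hA)]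
    have h5 : m - v ≤ θ * m := by nlinarith [mul_pos hθ0 hθ0, mul_pos hθ0 hv]
    linarith
  have hcard : (P.card : ℝ) * Q.card ≤ good.card + (1 + θ) * m * (θ * m) +
      (θ * m * m + m * (θ * m)) := by
    have h1 := (Finset.card_le_card hsub).trans (Finset.card_union_le _ _)
    have h2 := Finset.card_union_le good (B.biUnion fun g =>
      (Ω.filter fun x => ¬ x * g ∈ Ω).image fun x => (z * x, z * (x * g)))
    have h3 := Finset.card_union_le ((Ω \ A) ×ˢ Ω) (Ω ×ˢ (Ω \ A))
    rw [Finset.card_product, Finset.card_product] at h3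
    rw [Finset.card_product] at h1
    have h4 : (P.card : ℝ) * Q.card ≤ good.card + (B.biUnion fun g =>
      (Ω.filter fun x => ¬ x * g ∈ Ω).image fun x => (z * x, z * (x * g))).card +
      ((Ω \ A).card * Ω.card + Ω.card * (Ω \ A).card) := by
      exact_mod_cast h1.trans (add_le_add h2 h3)
    refine h4.trans ?_
    gcongr
  have hPm : (1 / 2 - 2 * θ) * m ≤ P.card := by linarith
  have hQm : 1 / 2 * m ≤ Q.card := by linarith
  have h6 : ((1 / 2 - 2 * θ) * m) * (1 / 2 * m) ≤ (P.card : ℝ) * Q.card :=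
    mul_le_mul hPm hQm (by positivity) (by positivity)
  have h7 : (1 / 16 + θ * 4 + θ * θ) * m ^ 2 ≤ 1 / 4 * m ^ 2 := by
    refine mul_le_mul_of_nonneg_right ?_ (by positivity)
    nlinarith
  nlinarith

/-- The functions `min (f x) (f (x g))`, for `0 ≤ f` supported in `Ω`, have energy at most
`4 |Ω|` times that of `f`, in total. -/
theorem tsum_energy_min_le {p : ℕ} (hp : p ≠ 0) (φ : G → ℝ≥0∞) (Ω : Finset G) (f : G → ℝ)
    (hf0 : ∀ x, 0 ≤ f x) (hf : Function.support f ⊆ (Ω : Set G)) :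
    ∑' g : G, energy p φ (fun x => min (f x) (f (x * g))) ≤ 4 * Ω.card * energy p φ f := by
  set c : G → ℝ≥0∞ := fun x => if x ∈ Ω then 1 else 0 with hc
  have hcsum : ∑' x, c x = Ω.card := by
    rw [tsum_eq_sum (s := Ω)]
    · simp [hc]
    · intro x hx
      simp [hc, hx]
  set E : G → G → ℝ≥0∞ := fun x y => ENNReal.ofReal (|f (y * x) - f x| ^ p) * φ y with hE
  have hfc : ∀ x, x ∉ Ω → f x = 0 := fun x hx => by
    by_contra h
    exact hx (hf h)
  have hmin0 : ∀ x g, (x ∉ Ω ∨ x * g ∉ Ω) → min (f x) (f (x * g)) = 0 := by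
    rintro x g (h | h)
    · rw [hfc x h]; exact min_eq_left (hf0 _)
    · rw [hfc _ h]; exact min_eq_right (hf0 _)
  have hpt : ∀ g x y, ENNReal.ofReal (|min (f (y * x)) (f (y * x * g)) -
      min (f x) (f (x * g))| ^ p) * φ y ≤
      E x y * (c (x * g) + c (y * x * g)) + E (x * g) y * (c x + c (y * x)) := by
    intro g x y
    simp only [hE, ← mul_assoc]
    by_cases h : (x * g ∈ Ω ∨ y * x * g ∈ Ω) ∧ (x ∈ Ω ∨ y * x ∈ Ω)
    · have h1 : 1 ≤ c (x * g) + c (y * x * g) := by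
        rcases h.1 with h | h <;> simp [hc, h]
      have h2 : 1 ≤ c x + c (y * x) := by
        rcases h.2 with h | h <;> simp [hc, h]
      refine le_trans ?_ (add_le_add (le_mul_of_one_le_right' h1) (le_mul_of_one_le_right' h2))
      rw [← add_mul, ← ENNReal.ofReal_add (by positivity) (by positivity)]
      refine mul_le_mul_left (ENNReal.ofReal_le_ofReal ?_) _
      have h3 := abs_min_sub_min_le_max (f (y * x)) (f (y * x * g)) (f x) (f (x * g))
      refine (pow_le_pow_left₀ (abs_nonneg _) h3 p).trans ?_
      rcases max_cases |f (y * x) - f x| |f (y * x * g) - f (x * g)| with h | h <;> rw [h.1]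
      · exact le_add_of_nonneg_right (by positivity)
      · exact le_add_of_nonneg_left (by positivity)
    · have h3 : min (f (y * x)) (f (y * x * g)) = 0 ∧ min (f x) (f (x * g)) = 0 := by
        constructor <;> apply hmin0 <;> tauto
      simp [h3.1, h3.2, hp]
  have hsum1 : ∑' g, ∑' x, ∑' y, E x y * (c (x * g) + c (y * x * g)) =
      2 * Ω.card * ∑' x, ∑' y, E x y := by
    rw [ENNReal.tsum_comm, ← ENNReal.tsum_mul_left]
    refine tsum_congr fun x => ?_
    rw [ENNReal.tsum_comm, ← ENNReal.tsum_mul_left]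
    refine tsum_congr fun y => ?_
    rw [ENNReal.tsum_mul_left, ENNReal.tsum_add]
    have h1 : ∀ w : G, ∑' g, c (w * g) = Ω.card := fun w => by
      rw [← hcsum]
      exact (Equiv.mulLeft w).tsum_eq c
    rw [h1, h1]
    ring
  have hsum2 : ∑' g, ∑' x, ∑' y, E (x * g) y * (c x + c (y * x)) =
      2 * Ω.card * ∑' x, ∑' y, E x y := by
    have h0 : ∀ g, ∑' x, ∑' y, E (x * g) y * (c x + c (y * x)) =
        ∑' x, ∑' y, E x y * (c (x * g⁻¹) + c (y * x * g⁻¹)) := by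
      intro g
      rw [← (Equiv.mulRight g).tsum_eq (fun x => ∑' y, E x y * (c (x * g⁻¹) + c (y * x * g⁻¹)))]
      simp [mul_assoc]
    simp_rw [h0]
    rw [← hsum1]
    exact (Equiv.inv G).tsum_eq (fun g => ∑' x, ∑' y, E x y * (c (x * g) + c (y * x * g)))
  calc ∑' g : G, energy p φ (fun x => min (f x) (f (x * g)))
      ≤ ∑' g : G, 2⁻¹ * ∑' x, ∑' y, (E x y * (c (x * g) + c (y * x * g)) +
          E (x * g) y * (c x + c (y * x))) := by
        refine ENNReal.tsum_le_tsum fun g => ?_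
        unfold energy
        gcongr with x y
        exact hpt g x y
    _ = 2⁻¹ * (2 * Ω.card * (∑' x, ∑' y, E x y) + 2 * Ω.card * ∑' x, ∑' y, E x y) := by
        simp_rw [ENNReal.tsum_mul_left, ENNReal.tsum_add]
        rw [hsum1, hsum2]
    _ = 4 * Ω.card * energy p φ f := by
        unfold energy
        ring

end Doubling

open Classical in
/-- If the energy of a function supported on slightly more than `v` points were much smaller than
the profile at `v`, the function would be nearly an indicator function of a set `Ω`, and its
products with suitable right translates, supported in `Ω ∩ Ω g⁻¹`, would have too small an energy. -/
theorem profile_le_mul_profile {G : Type u} [Group G] [Infinite G] {p : ℕ} (hp : p = 1 ∨ p = 2)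
    (μ : PMF G) (hμ : ∀ g, μ g⁻¹ = μ g) {η : ℝ} (hη : 0 < η)
    (hgen : Subgroup.closure {g : G | ENNReal.ofReal η ≤ μ g} = ⊤) {v : ℝ} (hv : 1 ≤ v) :
    profile p μ v ≤ ENNReal.ofReal (256 + 256 / η) * profile p μ ((1 + 1 / 32) * v) := by
  have hp0 : p ≠ 0 := by rcases hp with rfl | rfl <;> simp
  set K : ℝ := 256 + 256 / η with hK
  have hKη : 256 / η ≤ K := by linarith
  have hK256 : 256 ≤ K := by
    have : 0 < 256 / η := by positivity
    linarith
  have hK0 : 0 < K := by linarith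
  rw [mul_comm, ← ENNReal.div_le_iff (by simpa using hK0) ENNReal.ofReal_ne_top]
  refine le_profile fun Ω₀ f hΩ₀ hf₀ hf₀1 => ?_
  rw [ENNReal.div_le_iff (by simpa using hK0) ENNReal.ofReal_ne_top]
  by_contra! hlt
  have hΛ1 : profile p μ v ≤ 1 := profile_le_one hp0 μ hv
  set L := (profile p μ v).toReal with hL
  have hΛL : profile p μ v = ENNReal.ofReal L :=
    (ENNReal.ofReal_toReal (hΛ1.trans_lt ENNReal.one_lt_top).ne).symm
  have hEtop : energy p μ f ≠ ∞ := by
    intro h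
    rw [h, ENNReal.top_mul (by simpa using hK0)] at hlt
    exact absurd hlt not_top_lt
  set ε := (energy p μ f).toReal with hε
  have hE : energy p μ f = ENNReal.ofReal ε := (ENNReal.ofReal_toReal hEtop).symm
  have hε0 : 0 ≤ ε := ENNReal.toReal_nonneg
  have hL1 : L ≤ 1 := by rwa [hΛL, ENNReal.ofReal_le_one] at hΛ1
  have hεL : ε * K < L := by
    rw [hE, hΛL, ← ENNReal.ofReal_mul hε0] at hlt
    exact (ENNReal.ofReal_lt_ofReal_iff_of_nonneg (by positivity)).mp hlt
  have hL0 : 0 < L := lt_of_le_of_lt (by positivity) hεL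
  -- the support of `f` has more than `v` points
  set Ω := Ω₀.filter fun x => f x ≠ 0 with hΩ
  have hfΩ : Function.support f ⊆ (Ω : Set G) := fun x hx => by
    simpa [hΩ] using ⟨hf₀ hx, hx⟩
  have hΩne : ∀ x ∈ Ω, f x ≠ 0 := fun x hx => (Finset.mem_filter.mp hx).2
  have hf1 : ∑ x ∈ Ω, |f x| ^ p = 1 := by
    rw [← hf₀1]
    refine Finset.sum_subset (Finset.filter_subset _ _) fun x hx hxΩ => ?_
    have : f x = 0 := by simpa [hΩ, hx] using hxΩ
    simp [this, hp0]
  have hΩcard : (Ω.card : ℝ) ≤ (1 + 1 / 32) * v :=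
    le_trans (by exact_mod_cast Finset.card_le_card (Finset.filter_subset _ _)) hΩ₀
  have hvΩ : v < Ω.card := by
    by_contra! h
    have h1 := profile_le_energy (φ := μ) h hfΩ hf1
    rw [hΛL, hE, ENNReal.ofReal_le_ofReal_iff hε0] at h1
    nlinarith
  -- truncation at the level reached at more than `v` points
  obtain ⟨x₀, hx₀, hτ1, hτ2⟩ := exists_level Ω (fun x => |f x|) (N := ⌊v⌋₊ + 1) (by omega)
    ((Nat.floor_lt (by linarith)).mpr hvΩ)
  set τ := |f x₀| with hτ
  have hτ0 : 0 < τ := abs_pos.mpr (hΩne _ hx₀)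
  set A := Ω.filter fun x => τ ≤ |f x| with hA
  have hAΩ : A ⊆ Ω := Finset.filter_subset _ _
  have hAv : v ≤ A.card := by
    have h1 := Nat.lt_floor_add_one v
    have h2 : ((⌊v⌋₊ + 1 : ℕ) : ℝ) ≤ A.card := by exact_mod_cast hτ2
    push_cast at h2
    linarith
  set m : ℝ := (Ω.card : ℝ) with hm
  have hm0 : 0 < m := by linarith
  have htail : ∑ x ∈ Ω, max (|f x| - τ) 0 ^ p ≤ 1 / 4 := by
    set B := Ω.filter fun x => τ < |f x| with hB
    set h : G → ℝ := fun x => max (|f x| - τ) 0 with hh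
    have hhpos : ∀ x, h x ≠ 0 → τ < |f x| := fun x hx => by
      by_contra hle
      exact hx (max_eq_right (by linarith))
    have hsupp : Function.support h ⊆ (B : Set G) := by
      intro x hx
      have h1 := hhpos x hx
      have h2 : x ∈ Ω := hfΩ fun h0 => by
        rw [h0, abs_zero] at h1
        linarith
      simpa [hB] using ⟨h2, h1⟩
    have hBcard : (B.card : ℝ) ≤ v :=
      (Nat.cast_le.mpr (Nat.lt_succ_iff.mp hτ1)).trans (Nat.floor_le (by linarith))
    have h1 := (profile_mul_le_energy hp0 μ hBcard hsupp).trans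
      (energy_mono_of_abs_le (f := f) fun x y => by
        calc |h (y * x) - h x| ≤ |(|f (y * x)| - τ) - (|f x| - τ)| := abs_max_sub_max_le_abs _ _ _
          _ = |(|f (y * x)| - |f x|)| := by rw [sub_sub_sub_cancel_right]
          _ ≤ _ := abs_abs_sub_abs_le _ _)
    rw [hΛL, hE, ← ENNReal.ofReal_mul hL0.le, ENNReal.ofReal_le_ofReal_iff hε0] at h1
    have h2 : ∑ x ∈ B, |h x| ^ p = ∑ x ∈ Ω, h x ^ p := by
      have hh0 : ∀ x, |h x| = h x := fun x => abs_of_nonneg (le_max_right _ _)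
      simp only [hh0]
      refine Finset.sum_subset (Finset.filter_subset _ _) fun x _ hxB => ?_
      have : h x = 0 := by
        by_contra h0
        exact hxB (hsupp h0)
      simp [this, hp0]
    rw [h2] at h1
    by_contra! h3
    nlinarith
  have hτm : 1 / 4 ≤ τ ^ p * m := by
    have h1 : (1 : ℝ) ≤ ∑ x ∈ Ω, 2 * (max (|f x| - τ) 0 ^ p + τ ^ p) := by
      rw [← hf1]
      refine Finset.sum_le_sum fun x _ => ?_
      have h2 := abs_add_pow_le hp (max (|f x| - τ) 0) τ
      rw [abs_of_nonneg (le_max_right (|f x| - τ) 0), abs_of_pos hτ0] at h2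
      refine le_trans (pow_le_pow_left₀ (abs_nonneg _) ?_ p) h2
      have h3 := le_max_left (|f x| - τ) 0
      exact (by linarith : |f x| ≤ max (|f x| - τ) 0 + τ).trans (le_abs_self _)
    rw [← Finset.mul_sum, Finset.sum_add_distrib, Finset.sum_const, nsmul_eq_mul] at h1
    linarith
  have hεm : 0 ≤ 4 * ε * m := mul_nonneg (mul_nonneg zero_le_four hε0) hm0.le
  set f₁ : G → ℝ := fun x => min |f x| τ / τ with hf₁
  have hf₁0 : ∀ x, 0 ≤ f₁ x := fun x => div_nonneg (le_min (abs_nonneg _) hτ0.le) hτ0.le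
  have hf₁A : ∀ x ∈ A, f₁ x = 1 := fun x hx => by
    simp only [hf₁]
    rw [min_eq_right (Finset.mem_filter.mp hx).2, div_self hτ0.ne']
  have hf₁Ω : Function.support f₁ ⊆ (Ω : Set G) := fun x hx => hfΩ fun h0 => hx (by
    simp [hf₁, h0, hτ0.le])
  have hE₁ : energy p μ f₁ ≤ ENNReal.ofReal (4 * ε * m) := by
    have h1 : energy p μ (fun x => min |f x| τ) ≤ energy p μ f :=
      energy_mono_of_abs_le fun x y =>
        (abs_inf_sub_inf_le_abs _ _ _).trans (abs_abs_sub_abs_le _ _)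
    rw [hf₁, energy_div_const _ _ hτ0]
    refine (mul_le_mul_right h1 _).trans ?_
    rw [hE, ← ENNReal.ofReal_inv_of_pos (by positivity), ← ENNReal.ofReal_mul (by positivity)]
    refine ENNReal.ofReal_le_ofReal ?_
    rw [inv_mul_le_iff₀ (by positivity)]
    nlinarith
  -- `Ω` is nearly invariant under the generators
  set T := {g : G | ENNReal.ofReal η ≤ μ g} with hT
  have hinv : ∀ s ∈ T, (Ω.filter fun x => s * x ∉ Ω).card ≤ ⌊2 * (1 / 32) * m⌋₊ := by
    intro s hs
    refine Nat.le_floor ?_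
    have h1 : ((A.filter fun x => s * x ∉ Ω).card : ℝ) * η ≤ 8 * ε * m := by
      have h2 : ((A.filter fun x => s * x ∉ Ω).card : ℝ≥0∞) ≤ shiftCost p f₁ s := by
        calc ((A.filter fun x => s * x ∉ Ω).card : ℝ≥0∞)
            = ∑ x ∈ A.filter fun x => s * x ∉ Ω, 1 := by simp
          _ ≤ ∑ x ∈ A.filter fun x => s * x ∉ Ω, ENNReal.ofReal (|f₁ (s * x) - f₁ x| ^ p) := by
              refine Finset.sum_le_sum fun x hx => ?_
              obtain ⟨hxA, hsx⟩ := Finset.mem_filter.mp hx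
              have h0 : f₁ (s * x) = 0 := by
                by_contra h
                exact hsx (hf₁Ω h)
              simp [h0, hf₁A x hxA]
          _ ≤ _ := ENNReal.sum_le_tsum _
      have h3 : shiftCost p f₁ s * μ s ≤ 2 * energy p μ f₁ :=
        shiftCost_mul_le (j := MonoidHom.id G) f₁ s
      have h4 := (mul_le_mul' h2 hs).trans (h3.trans (mul_le_mul_right hE₁ 2))
      rw [← ENNReal.ofReal_natCast, ← ENNReal.ofReal_mul (Nat.cast_nonneg _),
        show (2 : ℝ≥0∞) = ENNReal.ofReal 2 by simp, ← ENNReal.ofReal_mul (by norm_num),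
        ENNReal.ofReal_le_ofReal_iff (mul_nonneg zero_le_two hεm)] at h4
      linarith
    have h2 : 8 * ε * m ≤ 1 / 32 * m * η := by
      have h3 : ε * (256 / η) ≤ 1 := by nlinarith
      rw [mul_div_assoc', div_le_one hη] at h3
      nlinarith
    have h3 : ((A.filter fun x => s * x ∉ Ω).card : ℝ) ≤ 1 / 32 * m :=
      le_of_mul_le_mul_right (h1.trans h2) hη
    have h4 : (Ω.filter fun x => s * x ∉ Ω) ⊆ (A.filter fun x => s * x ∉ Ω) ∪ (Ω \ A) := by
      intro x hx
      obtain ⟨h5, h6⟩ := Finset.mem_filter.mp hx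
      by_cases hxA : x ∈ A
      · exact Finset.mem_union_left _ (Finset.mem_filter.mpr ⟨hxA, h6⟩)
      · exact Finset.mem_union_right _ (Finset.mem_sdiff.mpr ⟨h5, hxA⟩)
    have h5 : ((Ω.filter fun x => s * x ∉ Ω).card : ℝ) ≤
        (A.filter fun x => s * x ∉ Ω).card + (Ω \ A).card := by
      exact_mod_cast (Finset.card_le_card h4).trans (Finset.card_union_le _ _)
    rw [Finset.card_sdiff_of_subset hAΩ, Nat.cast_sub (Finset.card_le_card hAΩ)] at h5
    linarith
  have hΩne : Ω.Nonempty := ⟨x₀, hx₀⟩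
  obtain ⟨z, hz1, hz2⟩ := exists_half_translate Ω hΩne T hgen
    (fun s hs => by simpa [hT, hμ] using hs) _ hinv
  have hpairs := card_pairs_le Ω A hAΩ z v (by linarith) (θ := 1 / 32) (by norm_num) le_rfl
    hΩcard hAv (by exact_mod_cast hz1) (by
      have h1 : m ≤ 2 * ((Ω.filter fun x => z⁻¹ * x ∈ Ω).card + ⌊2 * (1 / 32) * m⌋₊) := by
        rw [hm]
        exact_mod_cast hz2
      have h2 := Nat.floor_le (show 0 ≤ 2 * (1 / 32) * m from mul_nonneg (by norm_num) hm0.le)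
      linarith)
  -- sum the energies of the products over the right translates with a small intersection
  set good := (A ×ˢ A).filter fun w =>
      ((Ω.filter fun x => x * (w.1⁻¹ * w.2) ∈ Ω).card : ℝ) ≤ v with hgood
  set R := good.image fun w => w.1⁻¹ * w.2 with hR
  have hRlow : ∀ g ∈ R, ENNReal.ofReal L * ((good.filter fun w => w.1⁻¹ * w.2 = g).card : ℝ≥0∞) ≤
      energy p μ (fun x => min (f₁ x) (f₁ (x * g))) := by
    intro g hg
    obtain ⟨w, hw, rfl⟩ := Finset.mem_image.mp hg
    have hcard := (Finset.mem_filter.mp hw).2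
    set g := w.1⁻¹ * w.2 with hgdef
    have hsupp : Function.support (fun x => min (f₁ x) (f₁ (x * g))) ⊆
        ((Ω.filter fun x => x * g ∈ Ω : Finset G) : Set G) := by
      intro x hx
      rw [Finset.mem_coe, Finset.mem_filter]
      constructor
      · refine hf₁Ω fun h0 => hx ?_
        simp only [h0]
        exact min_eq_left (hf₁0 _)
      · refine hf₁Ω fun h0 => hx ?_
        simp only [h0]
        exact min_eq_right (hf₁0 _)
    have h1 := profile_mul_le_energy hp0 μ hcard hsupp
    rw [hΛL] at h1
    refine le_trans (mul_le_mul_right ?_ _) h1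
    rw [← ENNReal.ofReal_natCast]
    refine ENNReal.ofReal_le_ofReal ?_
    have h2 : (good.filter fun w => w.1⁻¹ * w.2 = g).card ≤
        (A.filter fun x => x * g ∈ A).card := by
      refine Finset.card_le_card_of_injOn Prod.fst (fun w' hw' => ?_) ?_
      · obtain ⟨h3, h4⟩ := Finset.mem_filter.mp hw'
        have h5 := Finset.mem_product.mp (Finset.mem_filter.mp h3).1
        refine Finset.mem_coe.mpr (Finset.mem_filter.mpr ⟨h5.1, ?_⟩)
        rw [← h4, mul_inv_cancel_left]
        exact h5.2
      · intro w₁ h3 w₂ h4 h5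
        have h6 := (Finset.mem_filter.mp h3).2.trans (Finset.mem_filter.mp h4).2.symm
        rw [h5] at h6
        exact Prod.ext h5 (mul_left_cancel h6)
    calc ((good.filter fun w => w.1⁻¹ * w.2 = g).card : ℝ) ≤ (A.filter fun x => x * g ∈ A).card := by
          exact_mod_cast h2
      _ = ∑ x ∈ A.filter fun x => x * g ∈ A, |min (f₁ x) (f₁ (x * g))| ^ p := by
          rw [Finset.sum_congr rfl fun x hx => ?_, Finset.sum_const, nsmul_one]
          obtain ⟨h3, h4⟩ := Finset.mem_filter.mp hx
          simp [hf₁A _ h3, hf₁A _ h4]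
      _ ≤ _ := by
          refine Finset.sum_le_sum_of_subset_of_nonneg (fun x hx => ?_) fun _ _ _ => by positivity
          obtain ⟨h3, h4⟩ := Finset.mem_filter.mp hx
          exact Finset.mem_filter.mpr ⟨hAΩ h3, hAΩ h4⟩
  have htotal : ENNReal.ofReal L * (good.card : ℝ≥0∞) ≤
      4 * Ω.card * ENNReal.ofReal (4 * ε * m) := by
    calc ENNReal.ofReal L * (good.card : ℝ≥0∞)
        = ∑ g ∈ R, ENNReal.ofReal L * ((good.filter fun w => w.1⁻¹ * w.2 = g).card : ℝ≥0∞) := by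
          rw [← Finset.mul_sum, ← Nat.cast_sum, ← Finset.card_eq_sum_card_image]
      _ ≤ ∑ g ∈ R, energy p μ (fun x => min (f₁ x) (f₁ (x * g))) := Finset.sum_le_sum hRlow
      _ ≤ ∑' g, energy p μ (fun x => min (f₁ x) (f₁ (x * g))) := ENNReal.sum_le_tsum _
      _ ≤ 4 * Ω.card * energy p μ f₁ := tsum_energy_min_le hp0 μ Ω f₁ hf₁0 hf₁Ω
      _ ≤ _ := by gcongr
  rw [← ENNReal.ofReal_natCast, ← ENNReal.ofReal_natCast, ← ENNReal.ofReal_mul hL0.le,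
    show (4 : ℝ≥0∞) = ENNReal.ofReal 4 by simp, ← ENNReal.ofReal_mul (by norm_num),
    ← ENNReal.ofReal_mul (mul_nonneg zero_le_four hm0.le),
    ENNReal.ofReal_le_ofReal_iff (mul_nonneg (mul_nonneg zero_le_four hm0.le) hεm)] at htotal
  have h1 : L * (m ^ 2 / 16) ≤ 4 * m * (4 * ε * m) :=
    (mul_le_mul_of_nonneg_left hpairs hL0.le).trans htotal
  have h2 : L ≤ 256 * ε := by
    have h3 : L * (m ^ 2 / 16) ≤ 256 * ε * (m ^ 2 / 16) := by linarith
    exact le_of_mul_le_mul_right h3 (div_pos (pow_pos hm0 2) (by norm_num))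
  nlinarith

/-! ### The three-cycle in the glued group -/

namespace CyclicSwitch

variable {Γ X H : Type*} [Group Γ] [MulAction Γ X] [Group H] {j : H →* Γ}
  {e : H → X} {a : H} {b : X} {t : Γ}

theorem mul_mul_eq_one [FaithfulSMul Γ X] (hs : CyclicSwitch j e a b t) : t * t * t = 1 := by
  refine eq_of_smul_eq_smul (α := X) fun x => ?_
  rw [one_smul, mul_smul, mul_smul]
  by_cases h1 : x = e 1
  · rw [h1, hs.t_one, hs.t_a, hs.t_b]
  by_cases h2 : x = e a
  · rw [h2, hs.t_a, hs.t_b, hs.t_one]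
  by_cases h3 : x = b
  · rw [h3, hs.t_b, hs.t_one, hs.t_a]
  · rw [hs.t_fix x h1 h2 h3, hs.t_fix x h1 h2 h3, hs.t_fix x h1 h2 h3]

end CyclicSwitch

section Glued

variable {ℓ : ℕ} {G : Fin ℓ → Type u} [∀ i, Group (G i)]

theorem gluedEmb_one (i : Fin ℓ) : gluedEmb G (fun _ => 1) i 1 = none :=
  dif_pos rfl

theorem gluedEmb_of_ne_one (i : Fin ℓ) {x : G i} (hx : x ≠ 1) :
    gluedEmb G (fun _ => 1) i x = some ⟨i, x, hx⟩ :=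
  dif_neg hx

theorem gluedEmb_ne {i k : Fin ℓ} (hik : i ≠ k) (x : G i) {y : G k} (hy : y ≠ 1) :
    gluedEmb G (fun _ => 1) i x ≠ gluedEmb G (fun _ => 1) k y := by
  rw [gluedEmb_of_ne_one k hy]
  by_cases hx : x = 1
  · rw [hx, gluedEmb_one]
    simp
  · rw [gluedEmb_of_ne_one i hx]
    intro h
    exact hik (congrArg Sigma.fst (Option.some_injective _ h))

theorem gluedAction_emb (i : Fin ℓ) (g x : G i) :
    gluedAction i g (gluedEmb G (fun _ => 1) i x) = gluedEmb G (fun _ => 1) i (g * x) := by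
  simp [gluedAction, Equiv.Perm.viaEmbeddingHom_apply, Equiv.Perm.viaEmbedding_apply]

theorem gluedAction_emb_of_ne {i k : Fin ℓ} (hik : i ≠ k) (g : G i) {y : G k} (hy : y ≠ 1) :
    gluedAction i g (gluedEmb G (fun _ => 1) k y) = gluedEmb G (fun _ => 1) k y := by
  simp only [gluedAction, MonoidHom.comp_apply, Equiv.Perm.viaEmbeddingHom_apply]
  refine Equiv.Perm.viaEmbedding_apply_of_notMem _ _ _ ?_
  rintro ⟨x, hx⟩
  exact gluedEmb_ne hik x hy hx

variable (S : ∀ i, Finset (G i)) (hS : ∀ i, Subgroup.closure (S i : Set (G i)) = ⊤)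

theorem gluedIncl_smul (i : Fin ℓ) (g : G i) (x : GluedVertices G fun _ => 1) :
    gluedIncl S hS i g • x = gluedAction i g x := rfl

/-- The commutator of `a ∈ G i` and `b ∈ G k`, for `i ≠ k`, is the three-cycle `(o, a, b)`. -/
theorem cyclicSwitch_commutator {i k : Fin ℓ} (hik : i ≠ k) {a : G i} (ha : a ≠ 1) {b : G k}
    (hb : b ≠ 1) :
    CyclicSwitch (gluedIncl S hS i) (gluedEmb G (fun _ => 1) i) a (gluedEmb G (fun _ => 1) k b)
      (gluedIncl S hS i a * gluedIncl S hS k b *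
        ((gluedIncl S hS i a)⁻¹ * (gluedIncl S hS k b)⁻¹)) := by
  have hroot : gluedEmb G (fun _ => 1) i 1 = gluedEmb G (fun _ => 1) k 1 := by
    rw [gluedEmb_one, gluedEmb_one]
  have hb' : b⁻¹ ≠ 1 := inv_ne_one.mpr hb
  have ha' : a⁻¹ ≠ 1 := inv_ne_one.mpr ha
  refine ⟨(gluedEmb G (fun _ => 1) i).injective, fun h => gluedEmb_ne hik h hb, ha, fun h g => ?_,
    fun h => ?_, ?_, ?_, ?_, fun x h1 h2 h3 => ?_⟩
  · rw [gluedIncl_smul, gluedAction_emb]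
  · rw [gluedIncl_smul, gluedAction_emb_of_ne hik h hb]
  all_goals simp only [mul_smul, ← map_inv, gluedIncl_smul]
  · rw [hroot, gluedAction_emb, mul_one, gluedAction_emb_of_ne hik _ hb', gluedAction_emb,
      mul_inv_cancel, ← hroot, gluedAction_emb, mul_one]
  · rw [gluedAction_emb_of_ne hik.symm _ ha, gluedAction_emb, inv_mul_cancel, hroot,
      gluedAction_emb, mul_one, gluedAction_emb_of_ne hik _ hb]
  · rw [gluedAction_emb, inv_mul_cancel, ← hroot, gluedAction_emb, mul_one,
      gluedAction_emb_of_ne hik.symm _ ha', gluedAction_emb, mul_inv_cancel]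
  · rcases x with _ | ⟨m, y, hy⟩
    · exact absurd (gluedEmb_one i).symm h1
    · rw [← gluedEmb_of_ne_one m hy] at h1 h2 h3 ⊢
      by_cases hmi : m = i
      · subst hmi
        have hay : a⁻¹ * y ≠ 1 := by
          rw [ne_eq, inv_mul_eq_one]
          exact fun h => h2 (by rw [h])
        rw [gluedAction_emb_of_ne hik.symm _ hy, gluedAction_emb,
          gluedAction_emb_of_ne hik.symm _ hay, gluedAction_emb, mul_inv_cancel_left]
      · by_cases hmk : m = k
        · subst hmk
          have hby : b⁻¹ * y ≠ 1 := by
            rw [ne_eq, inv_mul_eq_one]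
            exact fun h => h3 (by rw [h])
          rw [gluedAction_emb, gluedAction_emb_of_ne hik _ hby, gluedAction_emb,
            mul_inv_cancel_left, gluedAction_emb_of_ne hik _ hy]
        · rw [gluedAction_emb_of_ne (Ne.symm hmk) _ hy, gluedAction_emb_of_ne (Ne.symm hmi) _ hy,
            gluedAction_emb_of_ne (Ne.symm hmk) _ hy, gluedAction_emb_of_ne (Ne.symm hmi) _ hy]

theorem energyAlong_le_energy_gluedMeasure (p : ℕ) (μ : ∀ i, PMF (G i)) (f : gluedGroup S → ℝ)
    (i : Fin ℓ) :
    energyAlong (gluedIncl S hS i) p (μ i) f ≤ ℓ * energy p (gluedMeasure S hS μ) f := by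
  have hℓ : (ℓ : ℝ≥0∞) ≠ 0 := by
    have := i.pos
    exact_mod_cast this.ne'
  rw [← energy_map]
  have h : ∀ x y : gluedGroup S, ENNReal.ofReal (|f (y * x) - f x| ^ p) *
      (μ i).map (gluedIncl S hS i) y ≤
      ℓ * (ENNReal.ofReal (|f (y * x) - f x| ^ p) * gluedMeasure S hS μ y) := by
    intro x y
    rw [mul_left_comm]
    refine mul_le_mul_right ?_ _
    unfold gluedMeasure
    rw [← mul_assoc, ENNReal.mul_inv_cancel hℓ (ENNReal.natCast_ne_top ℓ), one_mul]
    exact Finset.single_le_sum (f := fun i => (μ i).map (gluedIncl S hS i) y)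
      (fun _ _ => zero_le) (Finset.mem_univ i)
  unfold energy
  rw [mul_left_comm]
  refine mul_le_mul_right ?_ _
  rw [← ENNReal.tsum_mul_left]
  refine ENNReal.tsum_le_tsum fun x => ?_
  rw [← ENNReal.tsum_mul_left]
  exact ENNReal.tsum_le_tsum (h x)

end Glued

/-! ### Generating sets of positive mass -/

theorem exists_ne_one_of_closure_eq_top {G : Type*} [Group G] [Nontrivial G] {T : Set G}
    (hT : Subgroup.closure T = ⊤) : ∃ g ∈ T, g ≠ 1 := by
  by_contra! h
  have h1 : Subgroup.closure T ≤ ⊥ := by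
    rw [Subgroup.closure_le]
    exact fun g hg => h g hg
  rw [hT] at h1
  exact absurd (top_le_iff.mp h1) bot_ne_top

/-- In a finitely generated group, a measure whose support generates gives mass at least `η > 0` to
each element of some generating set. -/
theorem exists_closure_eq_top {G : Type*} [Group G] (S : Finset G)
    (hS : Subgroup.closure (S : Set G) = ⊤) (μ : PMF G)
    (hμ : Subgroup.closure μ.support = ⊤) :
    ∃ η : ℝ, 0 < η ∧ Subgroup.closure {g : G | ENNReal.ofReal η ≤ μ g} = ⊤ := by
  set T : ℕ → Set G := fun n => {g | ENNReal.ofReal (1 / (n + 1)) ≤ μ g} with hT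
  have hTmono : Monotone T := fun m n hmn g hg =>
    (ENNReal.ofReal_le_ofReal (one_div_le_one_div_of_le (by positivity)
      (by exact_mod_cast Nat.succ_le_succ hmn))).trans hg
  have hcl : Monotone fun n => Subgroup.closure (T n) := fun m n hmn =>
    Subgroup.closure_mono (hTmono hmn)
  have hmem : ∀ g : G, ∃ n, g ∈ Subgroup.closure (T n) := by
    intro g
    rw [← Subgroup.mem_iSup_of_directed hcl.directed_le]
    have h1 : Subgroup.closure μ.support ≤ ⨆ n, Subgroup.closure (T n) := by
      rw [Subgroup.closure_le]
      intro x hx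
      rw [PMF.mem_support_iff] at hx
      have hx0 : 0 < (μ x).toReal := ENNReal.toReal_pos hx (μ.apply_ne_top x)
      obtain ⟨n, hn⟩ := exists_nat_one_div_lt hx0
      refine Subgroup.mem_iSup_of_mem n (Subgroup.subset_closure ?_)
      exact (ENNReal.ofReal_le_iff_le_toReal (μ.apply_ne_top x)).mpr hn.le
    exact h1 (by rw [hμ]; trivial)
  choose n hn using hmem
  refine ⟨1 / ((S.sup n : ℕ) + 1), by positivity, ?_⟩
  rw [eq_top_iff, ← hS, Subgroup.closure_le]
  exact fun g hg => hcl (Finset.le_sup (f := n) hg) (hn g)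

/-! ### Factorials -/

theorem gamma_add_one_lt_one {x : ℝ} (hx0 : 0 < x) (hx : x ≤ 1 / 2) : Real.Gamma (x + 1) < 1 := by
  have h := Real.convexOn_Gamma.2 (Set.mem_Ioi.mpr one_pos)
    (Set.mem_Ioi.mpr (show (0 : ℝ) < 3 / 2 by norm_num))
    (show 0 ≤ 1 - 2 * x by linarith) (show 0 ≤ 2 * x by linarith) (by ring)
  have h2 : (1 - 2 * x) • (1 : ℝ) + (2 * x) • (3 / 2 : ℝ) = x + 1 := by
    simp only [smul_eq_mul]
    ring
  rw [h2, Real.Gamma_one, smul_eq_mul, smul_eq_mul] at h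
  have h3 := Real.Gamma_three_div_two_lt_one
  nlinarith

theorem gamma_add_one_lt_factorial {y : ℝ} (hy : 50 < y) :
    Real.Gamma (1 / 100 * y + 1) < ((⌊y⌋₊ / 18).factorial : ℕ) := by
  set N := ⌊y⌋₊ with hN
  have hyN : y < N + 1 := Nat.lt_floor_add_one y
  have hN50 : 50 ≤ N := Nat.le_floor (by exact_mod_cast hy.le)
  set r := N / 18 with hr
  have hr2 : 2 ≤ r := by omega
  rcases le_or_gt y 100 with h | h
  · have h1 := Real.convexOn_Gamma.2 (Set.mem_Ioi.mpr one_pos)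
      (Set.mem_Ioi.mpr two_pos)
      (show 0 ≤ 1 - 1 / 100 * y by linarith) (show 0 ≤ 1 / 100 * y by linarith) (by ring)
    have h2 : (1 - 1 / 100 * y) • (1 : ℝ) + (1 / 100 * y) • (2 : ℝ) = 1 / 100 * y + 1 := by
      simp only [smul_eq_mul]
      ring
    rw [h2, Real.Gamma_one, Real.Gamma_two, smul_eq_mul, smul_eq_mul] at h1
    have h3 : (2 : ℝ) ≤ (r.factorial : ℕ) := by
      exact_mod_cast hr2.trans (Nat.self_le_factorial r)
    linarith
  · have hN100 : 100 ≤ N := Nat.le_floor (by exact_mod_cast h.le)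
    have h1 : N + 101 ≤ 100 * r := by omega
    have h1' : (N : ℝ) + 101 ≤ 100 * r := by exact_mod_cast h1
    have h2 : Real.Gamma (1 / 100 * y + 1) < Real.Gamma r :=
      Real.Gamma_strictMonoOn_Ici (Set.mem_Ici.mpr (by linarith))
        (Set.mem_Ici.mpr (by exact_mod_cast hr2)) (by linarith)
    obtain ⟨k, hk⟩ : ∃ k, r = k + 1 := ⟨r - 1, by omega⟩
    refine h2.trans_le ?_
    rw [hk, Nat.cast_add, Nat.cast_one, Real.Gamma_nat_eq_factorial]
    exact_mod_cast Nat.factorial_le (Nat.le_succ k)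

/-- `(4 w)! ≥ v` for `w = log (1 + v) / log (1 + log (1 + v))` and large `v`. -/
theorem eventually_le_gamma_logRatio :
    ∀ᶠ v : ℝ in atTop, 1 ≤ logRatio v ∧ v ≤ Real.Gamma (4 * logRatio v + 1) := by
  have hL : Tendsto (fun v : ℝ => Real.log (1 + v)) atTop atTop :=
    Real.tendsto_log_atTop.comp (tendsto_atTop_add_const_left _ _ tendsto_id)
  have hkey : ∀ᶠ x : ℝ in atTop, Real.log (1 + x) * Real.sqrt (1 + x) ≤ x := by
    have h1 : (fun x : ℝ => Real.log x) =o[atTop] fun x => x ^ (1 / 2 : ℝ) :=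
      isLittleO_log_rpow_atTop (by norm_num)
    have h2 := (h1.comp_tendsto (tendsto_atTop_add_const_left atTop (1 : ℝ) tendsto_id)).bound
      (show (0 : ℝ) < 1 / 2 by norm_num)
    filter_upwards [h2, eventually_ge_atTop 1] with x hx hx1
    simp only [Function.comp_apply, id_eq, ← Real.sqrt_eq_rpow, Real.norm_eq_abs] at hx
    rw [abs_of_nonneg (Real.log_nonneg (by linarith)), abs_of_nonneg (Real.sqrt_nonneg _)] at hx
    have h3 := Real.mul_self_sqrt (show 0 ≤ 1 + x by linarith)
    nlinarith [Real.sqrt_nonneg (1 + x)]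
  filter_upwards [hL.eventually hkey, hL.eventually (eventually_ge_atTop 1),
    eventually_ge_atTop 0] with v hv hL1 hv0
  unfold logRatio
  set L := Real.log (1 + v) with hLdef
  set w := L / Real.log (1 + L) with hw
  have hlog : 0 < Real.log (1 + L) := Real.log_pos (by linarith)
  have hsw : Real.sqrt (1 + L) ≤ w := by
    rw [hw, le_div_iff₀ hlog]
    linarith
  have hs1 : 1 ≤ Real.sqrt (1 + L) := Real.one_le_sqrt.mpr (by linarith)
  have hw1 : 1 ≤ w := hs1.trans hsw
  refine ⟨hw1, ?_⟩
  set n := ⌊4 * w⌋₊ with hn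
  have hn1 : (n : ℝ) ≤ 4 * w := Nat.floor_le (by linarith)
  have hn2 : 4 * w < n + 1 := Nat.lt_floor_add_one _
  have hfact : (n.factorial : ℝ) ≤ Real.Gamma (4 * w + 1) := by
    rw [← Real.Gamma_nat_eq_factorial]
    exact Real.Gamma_strictMonoOn_Ici.monotoneOn (Set.mem_Ici.mpr (by linarith))
      (Set.mem_Ici.mpr (by linarith)) (by linarith)
  refine le_trans ?_ hfact
  -- `n! ≥ (n / e) ^ n ≥ w ^ n ≥ (1 + L) ^ (n / 2) ≥ exp L`
  have h1 : (n : ℝ) ^ n / n.factorial ≤ Real.exp n :=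
    Real.pow_div_factorial_le_exp (n : ℝ) (Nat.cast_nonneg n) n
  have hfpos : (0 : ℝ) < n.factorial := by exact_mod_cast n.factorial_pos
  rw [div_le_iff₀ hfpos] at h1
  have he : Real.exp 1 < 3 := Real.exp_one_lt_d9.trans (by norm_num)
  have h2 : (w * Real.exp 1) ^ n ≤ (n : ℝ) ^ n :=
    pow_le_pow_left₀ (by positivity) (by nlinarith) n
  rw [mul_pow, ← Real.exp_nat_mul, mul_one] at h2
  have h3 : w ^ n ≤ n.factorial := by
    have := h2.trans h1
    rw [mul_comm] at this
    exact le_of_mul_le_mul_left this (Real.exp_pos _)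
  refine le_trans ?_ h3
  have hlogw : Real.log (1 + L) / 2 ≤ Real.log w := by
    rw [← Real.log_sqrt (by linarith)]
    exact Real.log_le_log (by linarith) hsw
  have h4 : L ≤ n * Real.log w := by
    have h5 : L = w * Real.log (1 + L) := by
      rw [hw]
      field_simp
    have h6 : 2 * w ≤ n := by linarith
    calc L = (2 * w) * (Real.log (1 + L) / 2) := by linarith
      _ ≤ n * Real.log w := mul_le_mul h6 hlogw (by positivity) (by positivity)
  calc v ≤ 1 + v := by linarith
    _ = Real.exp L := (Real.exp_log (by linarith)).symm
    _ ≤ Real.exp (n * Real.log w) := Real.exp_le_exp.mpr h4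
    _ = w ^ n := by rw [Real.exp_nat_mul, Real.exp_log (by linarith)]

/-! ### The lower bounds for the glued group -/

theorem lt_of_lt_rcInverse {Λ : ℝ → ℝ≥0∞} {s u : ℝ} (hu : 0 < u)
    (h : ENNReal.ofReal u < rcInverse Λ s) : ENNReal.ofReal s < Λ u := by
  by_contra! hle
  exact absurd h (not_lt.mpr (iInf_le_of_le u (iInf₂_le hu hle)))

section Bounds

variable {ℓ : ℕ} {G : Fin ℓ → Type u} [∀ i, Group (G i)]
  (S : ∀ i, Finset (G i)) (hS : ∀ i, Subgroup.closure (S i : Set (G i)) = ⊤)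
  {μ : ∀ i, PMF (G i)}

theorem factorial_le_card_of_energy_lt {p : ℕ} (hp : p = 1 ∨ p = 2) {i k : Fin ℓ} (hik : i ≠ k)
    [Infinite (G i)] [Nontrivial (G k)] {η : ℝ} (hη : 0 < η)
    (hgen : ∀ i, Subgroup.closure {g : G i | ENNReal.ofReal η ≤ μ i g} = ⊤)
    {s : ℝ} (hs0 : 0 < s) (hs1 : s ≤ 1) {N : ℕ} (hN : 1 ≤ N)
    (hs : ∀ n : ℕ, n < N → ENNReal.ofReal s ≤ profile p (μ i) n)
    {Ω : Finset (gluedGroup S)} {f : gluedGroup S → ℝ}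
    (hf : Function.support f ⊆ (Ω : Set (gluedGroup S))) (hf1 : ∑ x ∈ Ω, |f x| ^ p = 1)
    (hE : energy p (gluedMeasure S hS μ) f ≤ ENNReal.ofReal (min 1 η / 2 ^ 18 * s / ℓ)) :
    (N / 18).factorial ≤ Ω.card := by
  have hℓ : (0 : ℝ) < ℓ := by exact_mod_cast i.pos
  have hEi : ∀ i, energyAlong (gluedIncl S hS i) p (μ i) f ≤
      ENNReal.ofReal (min 1 η / 2 ^ 18 * s) := by
    intro i
    refine (energyAlong_le_energy_gluedMeasure S hS p μ f i).trans
      ((mul_le_mul_right hE _).trans ?_)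
    rw [← ENNReal.ofReal_natCast, ← ENNReal.ofReal_mul hℓ.le]
    refine ENNReal.ofReal_le_ofReal (le_of_eq ?_)
    field_simp
  have hcost : ∀ i, ∀ g : G i, ENNReal.ofReal η ≤ μ i g →
      shiftCost p f (gluedIncl S hS i g) ≤ ENNReal.ofReal (2 / 2 ^ 18) := by
    intro i g hg
    have h1 := (mul_le_mul_right hg _).trans
      ((shiftCost_mul_le (j := gluedIncl S hS i) (p := p) (φ := μ i) f g).trans
        (mul_le_mul_right (hEi i) 2))
    rw [← ENNReal.le_div_iff_mul_le (Or.inl (by simpa using hη)) (Or.inl ENNReal.ofReal_ne_top),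
      show (2 : ℝ≥0∞) = ENNReal.ofReal 2 by simp, ← ENNReal.ofReal_mul (by norm_num),
      ← ENNReal.ofReal_div_of_pos hη] at h1
    refine h1.trans (ENNReal.ofReal_le_ofReal ?_)
    rw [div_le_iff₀ hη]
    have h2 : min 1 η * s ≤ η :=
      (mul_le_of_le_one_right (le_min zero_le_one hη.le) hs1).trans (min_le_right _ _)
    linarith
  obtain ⟨a, ha, ha1⟩ := exists_ne_one_of_closure_eq_top (hgen i)
  obtain ⟨b, hb, hb1⟩ := exists_ne_one_of_closure_eq_top (hgen k)
  have hsw := cyclicSwitch_commutator S hS hik ha1 hb1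
  refine factorial_le_card_of_energyAlong_le hsw hsw.mul_mul_eq_one hp (φ := μ i) hN
    (by simpa using hs0) ENNReal.ofReal_ne_top hs hf hf1 ?_ ?_
  · refine (hEi i).trans ?_
    rw [← ENNReal.ofReal_mul hs0.le]
    refine ENNReal.ofReal_le_ofReal ?_
    have h2 : min 1 η * s ≤ s := mul_le_of_le_one_left hs0.le (min_le_left _ _)
    linarith
  · refine (shiftCost_commutator_le hp f _ _).trans
      ((mul_le_mul_right (add_le_add (hcost i a ha) (hcost k b hb)) _).trans ?_)
    rw [← ENNReal.ofReal_add (by norm_num) (by norm_num),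
      show (8 : ℝ≥0∞) = ENNReal.ofReal 8 by simp, ← ENNReal.ofReal_mul (by norm_num)]
    exact ENNReal.ofReal_le_ofReal (by norm_num)

theorem le_profile_gluedMeasure {p : ℕ} (hp : p = 1 ∨ p = 2) {i k : Fin ℓ} (hik : i ≠ k)
    [Infinite (G i)] [Nontrivial (G k)] {η : ℝ} (hη : 0 < η)
    (hgen : ∀ i, Subgroup.closure {g : G i | ENNReal.ofReal η ≤ μ i g} = ⊤)
    {v s : ℝ} (hs0 : 0 < s)
    (hv : ENNReal.ofReal v ≤
      extFactorial (ENNReal.ofReal (1 / 100) * rcInverse (profile p (μ i)) s)) :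
    ENNReal.ofReal (min 1 η / 2 ^ 18 * s / ℓ) ≤ profile p (gluedMeasure S hS μ) v := by
  have hp0 : p ≠ 0 := by rcases hp with rfl | rfl <;> simp
  refine le_profile fun Ω f hΩ hf hf1 => ?_
  by_contra! hlt
  have hΩ1 : 1 ≤ Ω.card := by
    rw [Nat.one_le_iff_ne_zero, Finset.card_ne_zero]
    rw [Finset.nonempty_iff_ne_empty]
    rintro rfl
    simp at hf1
  have hv1 : 1 ≤ v := le_trans (by exact_mod_cast hΩ1) hΩ
  set n := rcInverse (profile p (μ i)) s with hn
  have hprofile : ∀ m : ℕ, (m : ℝ≥0∞) < n → ENNReal.ofReal s ≤ profile p (μ i) m := by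
    intro m hm
    rcases Nat.eq_zero_or_pos m with rfl | h0
    · rw [profile_eq_top_of_lt_one p _ (by norm_num)]
      exact le_top
    · refine (lt_of_lt_rcInverse (by exact_mod_cast h0) ?_).le
      rwa [ENNReal.ofReal_natCast]
  have hn1 : 1 ≤ n := by
    refine le_iInf fun u => le_iInf₂ fun _ hu => ?_
    by_contra! h
    rw [← ENNReal.ofReal_one, ENNReal.ofReal_lt_ofReal_iff one_pos] at h
    rw [profile_eq_top_of_lt_one p _ h] at hu
    exact ENNReal.ofReal_ne_top (top_le_iff.mp hu)
  have hs1 : 1 < n → s ≤ 1 := by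
    intro h
    have h1 := (hprofile 1 (by exact_mod_cast h)).trans (profile_le_one hp0 (μ i) (by simp))
    rwa [ENNReal.ofReal_le_one] at h1
  by_cases htop : n = ∞
  · have h1 := factorial_le_card_of_energy_lt S hS hp hik hη hgen hs0 (hs1 (by simp [htop]))
      (N := 18 * (Ω.card + 3)) (by omega) (fun m _ => hprofile m (by simp [htop])) hf hf1 hlt.le
    rw [Nat.mul_div_cancel_left _ (by norm_num)] at h1
    have h2 := Nat.self_le_factorial (Ω.card + 3)
    omega
  · set y := n.toReal with hy
    have hny : n = ENNReal.ofReal y := (ENNReal.ofReal_toReal htop).symm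
    have hy1 : 1 ≤ y := by rwa [hny, ENNReal.one_le_ofReal] at hn1
    have hvΓ : v ≤ Real.Gamma (1 / 100 * y + 1) := by
      rw [hny, ← ENNReal.ofReal_mul (by norm_num), extFactorial, if_neg ENNReal.ofReal_ne_top,
        ENNReal.toReal_ofReal (by positivity), ENNReal.ofReal_le_ofReal_iff
          (Real.Gamma_pos_of_pos (by positivity)).le] at hv
      exact hv
    have hy50 : 50 < y := by
      by_contra! h
      have := gamma_add_one_lt_one (x := 1 / 100 * y) (by positivity) (by linarith)
      linarith
    have h1 := factorial_le_card_of_energy_lt S hS hp hik hη hgen hs0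
      (hs1 (by rw [hny, ENNReal.one_lt_ofReal]; linarith)) (N := ⌊y⌋₊)
      (Nat.le_floor (by exact_mod_cast hy1)) (fun m hm => hprofile m (by
        rw [hny, ← ENNReal.ofReal_natCast, ENNReal.ofReal_lt_ofReal_iff (by linarith)]
        exact Nat.lt_of_lt_floor hm)) hf hf1 hlt.le
    have h2 : (((⌊y⌋₊ / 18).factorial : ℕ) : ℝ) ≤ Ω.card := by exact_mod_cast h1
    have h3 := gamma_add_one_lt_factorial hy50
    linarith

theorem profile_le_pow_mul_profile {H : Type u} [Group H] [Infinite H] {p : ℕ}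
    (hp : p = 1 ∨ p = 2) (ν : PMF H) (hν : ∀ g, ν g⁻¹ = ν g) {η : ℝ} (hη : 0 < η)
    (hgen : Subgroup.closure {g : H | ENNReal.ofReal η ≤ ν g} = ⊤) {v : ℝ} (hv : 1 ≤ v) (n : ℕ) :
    profile p ν v ≤ ENNReal.ofReal (256 + 256 / η) ^ n * profile p ν ((1 + 1 / 32) ^ n * v) := by
  induction n with
  | zero => simp
  | succ n ih =>
    have h1 : 1 ≤ (1 + 1 / 32) ^ n * v :=
      one_le_mul_of_one_le_of_one_le (one_le_pow₀ (by norm_num)) hv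
    refine ih.trans ?_
    rw [pow_succ, mul_assoc, pow_succ', mul_assoc (1 + 1 / 32 : ℝ)]
    exact mul_le_mul_right (profile_le_mul_profile hp ν hν hη hgen h1) _

theorem mul_profile_logRatio_le {p : ℕ} (hp : p = 1 ∨ p = 2) (hμ : ∀ i g, μ i g⁻¹ = μ i g)
    {η : ℝ} (hη : 0 < η) (hgen : ∀ i, Subgroup.closure {g : G i | ENNReal.ofReal η ≤ μ i g} = ⊤)
    {n : ℕ} (hn : 400 ≤ (1 + 1 / 32 : ℝ) ^ n) {v : ℝ} (hw : 1 ≤ logRatio v)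
    (hv : v ≤ Real.Gamma (4 * logRatio v + 1)) {i k : Fin ℓ} (hik : i ≠ k) [Infinite (G i)]
    [Nontrivial (G k)] :
    ENNReal.ofReal (min 1 η / 2 ^ 18 / 2 / ℓ / (256 + 256 / η) ^ n) *
      profile p (μ i) (logRatio v) ≤ profile p (gluedMeasure S hS μ) v := by
  have hp0 : p ≠ 0 := by rcases hp with rfl | rfl <;> simp
  set w := logRatio v with hwdef
  set B : ℝ := (1 + 1 / 32) ^ n with hB
  set K : ℝ := 256 + 256 / η with hK
  have hK0 : 0 < K := by positivity
  have hm0 : 0 < min 1 η := lt_min one_pos hη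
  have hℓ : (0 : ℝ) < ℓ := by exact_mod_cast i.pos
  have hdoubling := profile_le_pow_mul_profile hp (μ i) (hμ i) hη (hgen i) hw n
  have hBw : 1 ≤ B * w := by nlinarith
  set L := (profile p (μ i) (B * w)).toReal with hL
  have hΛ : profile p (μ i) (B * w) = ENNReal.ofReal L :=
    (ENNReal.ofReal_toReal ((profile_le_one hp0 (μ i) hBw).trans_lt ENNReal.one_lt_top).ne).symm
  rw [hΛ, ← ENNReal.ofReal_pow hK0.le, ← ENNReal.ofReal_mul (by positivity)] at hdoubling
  rcases (show 0 ≤ L from ENNReal.toReal_nonneg).eq_or_lt with h0 | h0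
  · rw [← h0, mul_zero, ENNReal.ofReal_zero] at hdoubling
    rw [nonpos_iff_eq_zero.mp hdoubling, mul_zero]
    exact zero_le
  have hinv : ENNReal.ofReal (B * w) ≤ rcInverse (profile p (μ i)) (L / 2) := by
    refine le_iInf fun u => le_iInf₂ fun _ hu => ENNReal.ofReal_le_ofReal ?_
    by_contra! hlt
    have h1 := (profile_antitone p (μ i) hlt.le).trans hu
    rw [hΛ, ENNReal.ofReal_le_ofReal_iff (by linarith)] at h1
    linarith
  have hfact : ENNReal.ofReal v ≤
      extFactorial (ENNReal.ofReal (1 / 100) * rcInverse (profile p (μ i)) (L / 2)) := by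
    rw [extFactorial]
    split_ifs with htop
    · exact le_top
    · have h1 : B * w / 100 ≤
          (ENNReal.ofReal (1 / 100) * rcInverse (profile p (μ i)) (L / 2)).toReal := by
        rw [← ENNReal.ofReal_le_iff_le_toReal htop]
        refine le_trans (le_of_eq ?_) (mul_le_mul_right hinv _)
        rw [← ENNReal.ofReal_mul (by norm_num)]
        ring_nf
      refine ENNReal.ofReal_le_ofReal (hv.trans ?_)
      have h2 : 4 * w ≤ B * w / 100 := by nlinarith
      exact Real.Gamma_strictMonoOn_Ici.monotoneOn (Set.mem_Ici.mpr (by linarith))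
        (Set.mem_Ici.mpr (by linarith)) (by linarith)
  refine le_trans ?_ (le_profile_gluedMeasure S hS hp hik hη hgen (by linarith) hfact)
  refine (mul_le_mul_right hdoubling _).trans ?_
  rw [← ENNReal.ofReal_mul (by positivity)]
  refine ENNReal.ofReal_le_ofReal (le_of_eq ?_)
  field_simp

end Bounds

theorem theorem3p1 (p : ℕ) (hp : p = 1 ∨ p = 2) :
    ∃ c₂ : ℝ, 0 < c₂ ∧ ∃ c₁ : ℝ → ℝ, (∀ η : ℝ, 0 < η → 0 < c₁ η) ∧
      ∀ (ℓ : ℕ) (G : Fin ℓ → Type u) [∀ i, Group (G i)]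
        (S : ∀ i, Finset (G i)) (hS : ∀ i, Subgroup.closure (S i : Set (G i)) = ⊤)
        (μ : ∀ i, PMF (G i)),
        (∀ i g, μ i g⁻¹ = μ i g) →
        (∀ i, Subgroup.closure (μ i).support = ⊤) →
        (∃ i j, i ≠ j ∧ Infinite (G i) ∧ Nontrivial (G j)) →
        -- the data always have a positive lower bound `η` on generators
        (∃ η : ℝ, 0 < η ∧
          ∀ i, Subgroup.closure {g : G i | ENNReal.ofReal η ≤ μ i g} = ⊤) ∧
        -- the main bound; `c₁` depends on the data only through such a lower bound
        (∀ η : ℝ, 0 < η →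
          (∀ i, Subgroup.closure {g : G i | ENNReal.ofReal η ≤ μ i g} = ⊤) →
          ∀ v s : ℝ, 0 < v → 0 < s →
            ENNReal.ofReal v ≤ ⨆ (i : Fin ℓ) (_ : Infinite (G i)),
              extFactorial (ENNReal.ofReal c₂ * rcInverse (profile p (μ i)) s) →
            ENNReal.ofReal (c₁ η * s / ℓ) ≤ profile p (gluedMeasure S hS μ) v) ∧
        -- the asymptotic bound
        (∃ v₀ c C : ℝ, 0 < v₀ ∧ 0 < c ∧ 0 < C ∧ ∀ v : ℝ, v₀ ≤ v →
          ENNReal.ofReal c * (⨆ (i : Fin ℓ) (_ : Infinite (G i)),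
              profile p (μ i) (logRatio (C * v))) ≤
            profile p (gluedMeasure S hS μ) v) := by
  refine ⟨1 / 100, by norm_num, fun η => min 1 η / 2 ^ 18,
    fun η hη => div_pos (lt_min one_pos hη) (by positivity), ?_⟩
  intro ℓ G _ S hS μ hsymm hsupp hdata
  -- every infinite factor has a nontrivial companion
  have hpair : ∀ i, Infinite (G i) → ∃ k, i ≠ k ∧ Nontrivial (G k) := by
    obtain ⟨i₀, k₀, hne, hinf, hnt⟩ := hdata
    intro i _
    by_cases h : i = i₀
    · exact ⟨k₀, h ▸ hne, hnt⟩
    · exact ⟨i₀, h, inferInstance⟩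
  have hη : ∃ η : ℝ, 0 < η ∧
      ∀ i, Subgroup.closure {g : G i | ENNReal.ofReal η ≤ μ i g} = ⊤ := by
    choose η hη hgen using fun i => exists_closure_eq_top (S i) (hS i) (μ i) (hsupp i)
    have : Nonempty (Fin ℓ) := ⟨hdata.choose⟩
    refine ⟨Finset.univ.inf' Finset.univ_nonempty η, by simpa using hη, fun i => ?_⟩
    rw [eq_top_iff, ← hgen i]
    exact Subgroup.closure_mono fun g hg =>
      (ENNReal.ofReal_le_ofReal (Finset.inf'_le _ (Finset.mem_univ i))).trans hg
  refine ⟨hη, fun η hη hgen v s hv hs hle => ?_, ?_⟩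
  · have : Nonempty (Fin ℓ) := ⟨hdata.choose⟩
    obtain ⟨i, hi⟩ := exists_eq_ciSup_of_finite (f := fun i : Fin ℓ => ⨆ (_ : Infinite (G i)),
      extFactorial (ENNReal.ofReal (1 / 100) * rcInverse (profile p (μ i)) s))
    rw [← hi] at hle
    by_cases hinf : Infinite (G i)
    · rw [iSup_pos hinf] at hle
      obtain ⟨k, hik, hk⟩ := hpair i hinf
      exact le_profile_gluedMeasure S hS hp hik hη hgen hs hle
    · rw [iSup_neg hinf, bot_eq_zero, nonpos_iff_eq_zero, ENNReal.ofReal_eq_zero] at hle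
      exact absurd hle (not_le.mpr hv)
  · obtain ⟨η, hη, hgen⟩ := hη
    obtain ⟨n, hn⟩ := pow_unbounded_of_one_lt (400 : ℝ) (show (1 : ℝ) < 1 + 1 / 32 by norm_num)
    obtain ⟨v₀, hv₀⟩ := Filter.eventually_atTop.mp eventually_le_gamma_logRatio
    have hℓ : (0 : ℝ) < ℓ := by exact_mod_cast hdata.choose.pos
    have hm0 : 0 < min 1 η := lt_min one_pos hη
    refine ⟨max v₀ 1, min 1 η / 2 ^ 18 / 2 / ℓ / (256 + 256 / η) ^ n, 1, by positivity,
      by positivity, one_pos, fun v hv => ?_⟩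
    obtain ⟨h1, h2⟩ := hv₀ v ((le_max_left _ _).trans hv)
    simp only [one_mul, ENNReal.mul_iSup]
    refine iSup₂_le fun i hi => ?_
    obtain ⟨k, hik, hk⟩ := hpair i hi
    exact mul_profile_logRatio_le S hS hp hsymm hη hgen hn.le h1 h2 hik
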